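/- **Lemma 1.** Let $n\ge 1$, $\gamma>1$, and let $I\subset\mathbb R$ be an interval with non-empty interior (for instance $I=[0,T)$); time derivatives are taken within $I$, hence are one-sided at an end point belonging to $I$. Let $(\rho,v,p)$ be a classical ($C^1$) solution on $I\times\mathbb R^n$ of the gas dynamics equations $$\partial_t\rho+\operatorname{div}(\rho v)=0,\qquad \partial_t(\rho v)+\operatorname{div}(\rho v\otimes v)+\nabla p=0,\qquad \partial_t p+(v,\nabla p)+\gamma p\,\operatorname{div}v=0. \tag{GD}$$ Let $\mathcal V(t)$, $t\in I$, be a material volume: each $\mathcal V(t)$ is a bounded open set with $C^1$ boundary, every particle that lies in $\overline{\mathcal V(s)}$ at a time $s\in I$ has a trajectory $x(\cdot)$, $x'(t)=v(t,x(t))$, defined on all of $I$, and if it lies in $\mathcal V(s)$ at time $s$, then it lies in $\mathcal V(t)$ at every time $t\in I$. Let $\nu$ be the unit outer normal on $\partial\mathcal V(t)$. Let $\phi$ be a real function such that $x\mapsto\phi(|x|)$ is of class $C^2$ in a neighbourhood of each point of $\overline{\mathcal V(t)}$, $t\in I$, and put $$G_\phi(t)=\int_{\mathcal V(t)}\rho(t,x)\,\phi(|x|)\,dx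 .$$ Let $\sigma$ be the vector with components $v_ix_j-v_jx_i$, $i>j$, $i,j=1,\dots,n$. Then $G_\phi$ is twice differentiable on $I$, all the integrals below and the one defining $G_\phi$ converge absolutely, and for all $t\in I$ $$G_\phi'(t)=\int_{\mathcal V(t)}\frac{\phi'(|x|)}{|x|}(v,x)\,\rho\,dx,\qquad G_\phi''(t)=I_{1,\phi}(t)+I_{2,\phi}(t)+I_{3,\phi}(t)+I_{4,\phi}(t),$$ where $$I_{1,\phi}(t)=\int_{\mathcal V(t)}\frac{\phi''(|x|)}{|x|^2}\,|(v,x)|^2\rho\,dx,\qquad I_{2,\phi}(t)=\int_{\mathcal V(t)}\frac{\phi'(|x|)}{|x|^3}\,|\sigma|^2\rho\,dx,$$ $$I_{3,\phi}(t)=\int_{\mathcal V(t)}\Bigl(\phi''(|x|)+(n-1)\frac{\phi'(|x|)}{|x|}\Bigr)p\,dx,\qquad I_{4,\phi}(t)=-\int_{\partial\mathcal V(t)}\frac{\phi'(|x|)}{|x|}\,(x,\nu)\,p\;d\,\partial\mathcal V .$$ (Here $d\,\partial\mathcal V$ is the surface measure, which for $n=1$ is the counting measure. If $0\in\partial\mathcal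 V(t)$, the integrand of $I_{4,\phi}$ is read as $0$ at $x=0$.) -/

import Mathlib

open MeasureTheory Set Filter Topology
open scoped InnerProductSpace

noncomputable section

/-- The `i`-th partial derivative at `x` of a real function on `ℝⁿ`. -/
def partialDeriv {n : ℕ} (i : Fin n) (f : EuclideanSpace ℝ (Fin n) → ℝ)
    (x : EuclideanSpace ℝ (Fin n)) : ℝ :=
  fderiv ℝ f x (EuclideanSpace.single i 1)

/-- `(ρ, v, p)` is a classical (i.e. `C¹`) solution on `I × ℝⁿ` of the gas dynamics equations
with heat ratio `γ`:
`∂ₜρ + div (ρ v) = 0`, `∂ₜ(ρ v) + div (ρ v ⊗ v) + ∇p = 0`, `∂ₜp + (v, ∇p) + γ p div v = 0`.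
Time derivatives are taken within the time interval `I`, so they are one-sided at an end point
that belongs to `I`. No sign condition on `ρ` or `p` is imposed. -/
structure IsGDSolution {n : ℕ} (γ : ℝ) (I : Set ℝ) (ρ : ℝ → EuclideanSpace ℝ (Fin n) → ℝ)
    (v : ℝ → EuclideanSpace ℝ (Fin n) → EuclideanSpace ℝ (Fin n))
    (p : ℝ → EuclideanSpace ℝ (Fin n) → ℝ) : Prop where
  contDiffOn_density :
    ContDiffOn ℝ 1 (fun z : ℝ × EuclideanSpace ℝ (Fin n) => ρ z.1 z.2) (I ×ˢ univ)
  contDiffOn_velocity :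
    ContDiffOn ℝ 1 (fun z : ℝ × EuclideanSpace ℝ (Fin n) => v z.1 z.2) (I ×ˢ univ)
  contDiffOn_pressure :
    ContDiffOn ℝ 1 (fun z : ℝ × EuclideanSpace ℝ (Fin n) => p z.1 z.2) (I ×ˢ univ)
  mass : ∀ t ∈ I, ∀ x,
    derivWithin (fun τ => ρ τ x) I t + ∑ j, partialDeriv j (fun y => ρ t y * v t y j) x = 0
  momentum : ∀ t ∈ I, ∀ x, ∀ i,
    derivWithin (fun τ => ρ τ x * v τ x i) I t
      + ∑ j, partialDeriv j (fun y => ρ t y * v t y i * v t y j) x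
      + partialDeriv i (p t) x = 0
  pressure : ∀ t ∈ I, ∀ x,
    derivWithin (fun τ => p τ x) I t + ∑ j, v t x j * partialDeriv j (p t) x
      + γ * p t x * ∑ j, partialDeriv j (fun y => v t y j) x = 0

/-- Near `x₀`, the set `U` is the part below the graph, in the direction of the unit vector `e`,
of a function `g` of the coordinates orthogonal to `e` (a function on the hyperplane orthogonal
to `e` is represented by the function on the whole space that is constant along `e`), and this
function is `C¹` near `x₀`. -/
structure IsLocalSubgraph {n : ℕ} (U : Set (EuclideanSpace ℝ (Fin n)))
    (x₀ e : EuclideanSpace ℝ (Fin n)) (g : EuclideanSpace ℝ (Fin n) → ℝ) : Prop where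
  norm_eq_one : ‖e‖ = 1
  contDiffAt : ContDiffAt ℝ 1 g x₀
  const_along : ∀ y : EuclideanSpace ℝ (Fin n), ∀ s : ℝ, g (y + s • e) = g y
  mem_iff : ∀ᶠ x in 𝓝 x₀, x ∈ U ↔ ⟪e, x⟫_ℝ < g x

/-- Bounded open sets with `C¹` boundary. -/
structure IsBoundedC1Domain {n : ℕ} (U : Set (EuclideanSpace ℝ (Fin n))) : Prop where
  isOpen : IsOpen U
  isBounded : Bornology.IsBounded U
  boundary : ∀ x₀ ∈ frontier U, ∃ e g, IsLocalSubgraph U x₀ e g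

/-- `ν` is the unit outer normal to `U` at the boundary point `x`: if `U` is given near `x` by
`⟪e, y⟫ - g y < 0`, then `ν` is the normalized gradient `e - ∇g` of the left-hand side. -/
def IsOuterUnitNormal {n : ℕ} (U : Set (EuclideanSpace ℝ (Fin n)))
    (x ν : EuclideanSpace ℝ (Fin n)) : Prop :=
  ∃ e g, IsLocalSubgraph U x e g ∧ ν = ‖e - gradient g x‖⁻¹ • (e - gradient g x)

/-- `V t`, `t ∈ I`, is a material volume of the flow with velocity `v`: every particle that
is in the closed region `closure (V s)` at a time `s ∈ I` has a trajectory during all of `I`,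
and if it is in `V s`, then it is in `V t` at every time `t ∈ I`. -/
def IsMaterialVolume {n : ℕ} (I : Set ℝ)
    (v : ℝ → EuclideanSpace ℝ (Fin n) → EuclideanSpace ℝ (Fin n))
    (V : ℝ → Set (EuclideanSpace ℝ (Fin n))) : Prop :=
  ∀ s ∈ I, ∀ x ∈ closure (V s), ∃ z : ℝ → EuclideanSpace ℝ (Fin n),
    z s = x ∧ (∀ t ∈ I, HasDerivWithinAt z (v t (z t)) I t) ∧ (x ∈ V s → ∀ t ∈ I, z t ∈ V t)

/-- The vector `σ` with the components `uᵢ xⱼ - uⱼ xᵢ`, `i > j`, with its Euclidean norm. -/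
def angularPart {n : ℕ} (u x : EuclideanSpace ℝ (Fin n)) :
    EuclideanSpace ℝ {q : Fin n × Fin n // q.2 < q.1} :=
  WithLp.toLp 2 fun q => u q.1.1 * x q.1.2 - u q.1.2 * x q.1.1

/-- The generalized momentum of mass `G_φ(t)`, the integral of `ρ(t, x) φ(|x|)` over `V(t)`. -/
def generalizedMomentum {n : ℕ} (φ : ℝ → ℝ) (ρ : ℝ → EuclideanSpace ℝ (Fin n) → ℝ)
    (V : ℝ → Set (EuclideanSpace ℝ (Fin n))) (t : ℝ) : ℝ :=
  ∫ x in V t, ρ t x * φ ‖x‖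

end

/-! Near the closure of `V t` the weight φ(|x|) agrees with a compactly supported C² function Φ on
the whole space, and for times close to t the material volume stays where they agree; so Φ may
replace φ(|x|) in both differentiations. Reynolds' theorem gives d/ds ∫ f = ∫ (Df + f div v), where
D is the derivative along trajectories. For f = ρΦ the continuity equation leaves ∫ ρ (∇Φ, v)
(`hasDerivWithinAt_integral_density_mul`). For f = ρ (∇Φ, v) the momentum equation leaves ∫ ρ Hess
Φ(v,v) − (∇Φ, ∇p), and the divergence theorem turns the pressure part into ∫ p ΔΦ minus the boundary
integral of p (∇Φ, ν) (`hasDerivWithinAt_integral_momentum`). The Hessian of a radial function and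
Lagrange's identity |σ|² = |v|²|x|² − (v,x)² then split the first integral into I₁ + I₂, and the
Laplacian gives I₃.

The divergence theorem `IsBoundedC1Domain.integral_fderiv_eq` is local: a shear flattens a C¹
subgraph, Fubini and the fundamental theorem of calculus give a boundary integral in graph
coordinates, and the area formula for graphs identifies it with an integral for Hausdorff measure.
Bump functions glue the local statements.

Reynolds' theorem `hasDerivWithinAt_integral_of_trajectories` avoids differentiable dependence of
trajectories on their initial points. Gronwall-type estimates make the flow map Lipschitz, hence
differentiable almost everywhere, with Jacobian matrix 1 + (s − t)∇v + o(s − t); change of variables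
to the fixed domain `V t` and dominated convergence finish the proof. -/

/-! ### Divergence theorem below a C¹ graph. -/

section SubgraphDivergence

variable {E : Type*} [NormedAddCommGroup E] [InnerProductSpace ℝ E] [FiniteDimensional ℝ E]
  [MeasurableSpace E] [BorelSpace E]

/-- Orthogonal coordinates along a unit vector preserve the volume. -/
theorem measurePreserving_orthogonal_add_smul {e : E} (he : ‖e‖ = 1) :
    MeasurePreserving (fun z : (ℝ ∙ e)ᗮ × ℝ => (z.1 : E) + z.2 • e)
      (volume.prod volume) volume := by
  have he0 : e ≠ 0 := by intro h; simp [h] at he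
  let L : WithLp 2 ((ℝ ∙ e)ᗮ × ℝ) →ₗ[ℝ] E :=
    { toFun := fun z => (z.fst : E) + z.snd • e
      map_add' := fun a b => by simp [add_smul]; abel
      map_smul' := fun c a => by simp [smul_smul] }
  have hL : ∀ z, ‖L z‖ = ‖z‖ := by
    intro z
    have h0 : ⟪(z.fst : E), z.snd • e⟫_ℝ = 0 := by
      rw [inner_smul_right, Submodule.mem_orthogonal_singleton_iff_inner_left.1 z.fst.2, mul_zero]
    have h1 := norm_add_sq_eq_norm_sq_add_norm_sq_of_inner_eq_zero _ _ h0
    have h2 := WithLp.prod_norm_sq_eq_of_L2 z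
    have h3 : ‖L z‖ ^ 2 = ‖z‖ ^ 2 := by
      rw [h2, sq]
      refine h1.trans ?_
      rw [norm_smul, he, mul_one]
      simp [sq]
    exact (sq_eq_sq₀ (norm_nonneg _) (norm_nonneg _)).1 h3
  have hfin : Module.finrank ℝ (WithLp 2 ((ℝ ∙ e)ᗮ × ℝ)) = Module.finrank ℝ E := by
    rw [(WithLp.linearEquiv 2 ℝ ((ℝ ∙ e)ᗮ × ℝ)).finrank_eq, Module.finrank_prod,
      Module.finrank_self, ← (ℝ ∙ e).finrank_add_finrank_orthogonal, finrank_span_singleton he0]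
    ring
  let Φ := (LinearIsometry.mk L hL).toLinearIsometryEquiv hfin
  exact (Φ.measurePreserving).comp (WithLp.volume_preserving_toLp _ _)

/-- The shear map `(y, s) ↦ y + (s + g y) e` onto the coordinates over the graph of `g`. -/
def graphShear (e : E) (g : E → ℝ) (z : (ℝ ∙ e)ᗮ × ℝ) : E := (z.1 : E) + (z.2 + g z.1) • e

/-- On each line parallel to `e` the shear is a translation, so this is Fubini. -/
theorem measurePreserving_graphShear {e : E} (he : ‖e‖ = 1) {g : E → ℝ} (hg : Continuous g) :
    MeasurePreserving (graphShear e g) (volume.prod volume) volume := by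
  have h := MeasurePreserving.skew_product (μa := (volume : Measure (ℝ ∙ e)ᗮ))
    (μc := (volume : Measure ℝ)) (μd := (volume : Measure ℝ)) (MeasurePreserving.id _)
    (g := fun y s => s + g y) (by fun_prop)
    (Eventually.of_forall fun y => (measurePreserving_add_right volume (g y)).map_eq)
  exact (measurePreserving_orthogonal_add_smul he).comp h

omit [FiniteDimensional ℝ E] [MeasurableSpace E] [BorelSpace E] in
theorem inner_coe_orthogonal_singleton {e : E} (y : (ℝ ∙ e)ᗮ) : ⟪e, (y : E)⟫_ℝ = 0 :=
  Submodule.mem_orthogonal_singleton_iff_inner_right.1 y.2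

omit [FiniteDimensional ℝ E] [MeasurableSpace E] [BorelSpace E] in
theorem inner_graphShear {e : E} (he : ‖e‖ = 1) (g : E → ℝ) (z : (ℝ ∙ e)ᗮ × ℝ) :
    ⟪e, graphShear e g z⟫_ℝ = z.2 + g z.1 := by
  simp [graphShear, inner_add_right, inner_smul_right, inner_coe_orthogonal_singleton, he]

omit [FiniteDimensional ℝ E] [MeasurableSpace E] [BorelSpace E] in
theorem fderiv_apply_eq_zero_of_const_along {e : E} {g : E → ℝ} (hg : ContDiff ℝ 1 g)
    (hge : ∀ (y : E) (s : ℝ), g (y + s • e) = g y) (y : E) : fderiv ℝ g y e = 0 := by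
  have h1 : HasLineDerivAt ℝ g (fderiv ℝ g y e) y e :=
    ((hg.differentiable one_ne_zero) y).hasFDerivAt.hasLineDerivAt e
  have h2 : HasLineDerivAt ℝ g 0 y e := by
    unfold HasLineDerivAt
    simp only [hge]
    exact hasDerivAt_const _ _
  exact HasDerivAt.unique h1 h2

/-- The divergence theorem for the region below a `C¹` graph, in graph coordinates. -/
theorem integral_subgraph_fderiv {e : E} (he : ‖e‖ = 1) {g : E → ℝ} (hg : ContDiff ℝ 1 g)
    (hge : ∀ (y : E) (s : ℝ), g (y + s • e) = g y) {f : E → ℝ} (hf : ContDiff ℝ 1 f)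
    (hfc : HasCompactSupport f) (w : E) :
    ∫ x in {x | ⟪e, x⟫_ℝ < g x}, fderiv ℝ f x w
      = ∫ y : (ℝ ∙ e)ᗮ, f (y + g y • e) * (⟪e, w⟫_ℝ - fderiv ℝ g y w) := by
  set Ψ := graphShear e g with hΨ
  have hΨm := measurePreserving_graphShear he hg.continuous
  have hΨc : ContDiff ℝ 1 Ψ := by
    have : ContDiff ℝ 1 (fun z : (ℝ ∙ e)ᗮ × ℝ => (z.1 : E)) :=
      ((ℝ ∙ e)ᗮ.subtypeL.contDiff).comp contDiff_fst
    exact this.add ((contDiff_snd.add (hg.comp this)).smul contDiff_const)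
  -- Since `g` is constant along `e`, the shear straightens the subgraph to the half-space s < 0.
  have hpre : Ψ ⁻¹' {x | ⟪e, x⟫_ℝ < g x} = univ ×ˢ Iio (0 : ℝ) := by
    ext z
    simp only [mem_preimage, mem_ofPred_eq, hΨ, inner_graphShear he, mem_prod, mem_univ, true_and,
      mem_Iio]
    rw [graphShear, hge]
    constructor <;> intro h <;> linarith
  set k : (ℝ ∙ e)ᗮ × ℝ → ℝ := fun z => f (Ψ z) with hk
  have hkc : ContDiff ℝ 1 k := hf.comp hΨc
  have hks : HasCompactSupport k := by
    -- This is the inverse of the shear; it carries the support of `f` to a compact set outside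
    -- which `k` vanishes.
    have hinv : Continuous fun x : E =>
        (((ℝ ∙ e)ᗮ.orthogonalProjectionOnto x, ⟪e, x⟫_ℝ - g x) : (ℝ ∙ e)ᗮ × ℝ) := by
      have := hg.continuous
      fun_prop
    refine HasCompactSupport.intro (hfc.isCompact.image hinv) fun z hz => ?_
    by_contra hne
    refine hz ⟨Ψ z, subset_tsupport _ hne, ?_⟩
    refine Prod.ext ?_ ?_
    · have h1 : (ℝ ∙ e)ᗮ.orthogonalProjectionOnto e = 0 := by
        rw [Submodule.orthogonalProjectionOnto_eq_zero_iff, Submodule.orthogonal_orthogonal]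
        exact Submodule.mem_span_singleton_self e
      simp [hΨ, graphShear, h1]
    · simp only [hΨ, inner_graphShear he]
      rw [graphShear, hge]
      ring
  set w' : (ℝ ∙ e)ᗮ := ⟨w - ⟪e, w⟫_ℝ • e, Submodule.mem_orthogonal_singleton_iff_inner_right.2 (by
    rw [inner_sub_right, inner_smul_right, real_inner_self_eq_norm_sq, he]; ring)⟩ with hw'
  have hw : w = (w' : E) + ⟪e, w⟫_ℝ • e := by simp [hw']
  have hgw : ∀ y : E, fderiv ℝ g y w = fderiv ℝ g y w' := by
    intro y
    conv_lhs => rw [hw]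
    simp [fderiv_apply_eq_zero_of_const_along hg hge]
  set h : (ℝ ∙ e)ᗮ → ℝ := fun y => ⟪e, w⟫_ℝ - fderiv ℝ g y w with hh
  have hhc : Continuous h := by
    have := (hg.continuous_fderiv one_ne_zero)
    fun_prop
  -- The coefficient `h` does not depend on the vertical coordinate, so it can leave the vertical
  -- integral.
  have hder : ∀ z, fderiv ℝ f (Ψ z) w
      = fderiv ℝ k z (w', 0) + h z.1 * fderiv ℝ k z (0, 1) := by
    intro z
    have hΨd : HasFDerivAt Ψ
        ((ℝ ∙ e)ᗮ.subtypeL.comp (ContinuousLinearMap.fst ℝ _ ℝ)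
          + ((ContinuousLinearMap.snd ℝ _ ℝ) + (fderiv ℝ g z.1).comp
            ((ℝ ∙ e)ᗮ.subtypeL.comp (ContinuousLinearMap.fst ℝ _ ℝ))).smulRight e) z := by
      have h1 : HasFDerivAt (fun z : (ℝ ∙ e)ᗮ × ℝ => (z.1 : E))
          ((ℝ ∙ e)ᗮ.subtypeL.comp (ContinuousLinearMap.fst ℝ _ ℝ)) z :=
        ((ℝ ∙ e)ᗮ.subtypeL.comp (ContinuousLinearMap.fst ℝ _ ℝ)).hasFDerivAt
      have h2 : HasFDerivAt (fun z : (ℝ ∙ e)ᗮ × ℝ => g z.1) _ z :=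
        ((hg.differentiable one_ne_zero) (z.1 : E)).hasFDerivAt.comp z h1
      exact h1.add (((hasFDerivAt_snd).add h2).smul_const e)
    have hkd : fderiv ℝ k z = (fderiv ℝ f (Ψ z)).comp _ :=
      (((hf.differentiable one_ne_zero) (Ψ z)).hasFDerivAt.comp z hΨd).fderiv
    rw [hkd]
    conv_lhs => rw [hw]
    simp only [hh, hgw]
    simp
    ring
  have hAc : Continuous fun z => fderiv ℝ k z (w', 0) := by
    have := hkc.continuous_fderiv one_ne_zero
    fun_prop
  have hBc : Continuous fun z => fderiv ℝ k z (0, 1) := by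
    have := hkc.continuous_fderiv one_ne_zero
    fun_prop
  have hcs : ∀ u, HasCompactSupport fun z => fderiv ℝ k z u := fun u =>
    (hks.fderiv (𝕜 := ℝ)).comp_left (g := fun A : ((ℝ ∙ e)ᗮ × ℝ) →L[ℝ] ℝ => A u) (by simp)
  have hAi : Integrable (fun z => fderiv ℝ k z (w', 0)) (volume.prod volume) :=
    hAc.integrable_of_hasCompactSupport (hcs _)
  have hBi : Integrable (fun z => h z.1 * fderiv ℝ k z (0, 1)) (volume.prod volume) :=
    ((hhc.comp continuous_fst).mul hBc).integrable_of_hasCompactSupport ((hcs _).mul_left)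
  have hkd : ∀ z, HasFDerivAt k (fderiv ℝ k z) z := fun z =>
    ((hkc.differentiable one_ne_zero) z).hasFDerivAt
  calc ∫ x in {x | ⟪e, x⟫_ℝ < g x}, fderiv ℝ f x w
      = ∫ z in univ ×ˢ Iio (0 : ℝ), fderiv ℝ f (Ψ z) w ∂(volume.prod volume) := by
        rw [← hΨm.map_eq, setIntegral_map, ← hpre]
        · exact measurableSet_lt (by fun_prop) hg.continuous.measurable
        · have := hf.continuous_fderiv one_ne_zero
          exact (by fun_prop : Continuous fun x => fderiv ℝ f x w).aestronglyMeasurable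
        · exact hΨm.aemeasurable
    _ = (∫ z in univ ×ˢ Iio (0 : ℝ), fderiv ℝ k z (w', 0) ∂(volume.prod volume))
        + ∫ z in univ ×ˢ Iio (0 : ℝ), h z.1 * fderiv ℝ k z (0, 1) ∂(volume.prod volume) := by
        rw [← integral_add hAi.integrableOn hBi.integrableOn]
        simp only [hder]
    _ = 0 + ∫ y, h y * k (y, 0) := by
        -- The horizontal derivative integrates to zero over every slice s = const; the vertical one
        -- integrates over s < 0 to the value at s = 0.
        congr 1
        · rw [← Measure.prod_restrict, integral_prod_symm _ (by
            rw [Measure.prod_restrict]; exact hAi.integrableOn)]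
          rw [Measure.restrict_univ]
          refine integral_eq_zero_of_ae (Eventually.of_forall fun s => ?_)
          have hks' : ContDiff ℝ 1 fun y => k (y, s) := hkc.comp (contDiff_prodMk_left s)
          have hcs' : HasCompactSupport fun y => k (y, s) :=
            HasCompactSupport.intro (hks.isCompact.image continuous_fst) fun y hy => by
              by_contra hne
              exact hy ⟨(y, s), subset_tsupport _ hne, rfl⟩
          have hd : ∀ y, fderiv ℝ k (y, s) (w', 0) = fderiv ℝ (fun y => k (y, s)) y w' := by
            intro y
            have := HasFDerivAt.comp (g := k) (f := fun y => (y, s)) y (hkd (y, s))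
              (hasFDerivAt_prodMk_left y s)
            rw [show (fun y => k (y, s)) = k ∘ fun y => (y, s) from rfl, this.fderiv]
            simp
          simp only [hd, Pi.zero_apply]
          have := integral_mul_fderiv_eq_neg_fderiv_mul_of_integrable (μ := volume)
            (f := fun _ : (ℝ ∙ e)ᗮ => (1 : ℝ)) (g := fun y => k (y, s)) (v := w')
            (by simp) (by
              simp only [one_mul]
              have h3 := hks'.continuous_fderiv one_ne_zero
              exact (by fun_prop : Continuous fun y => fderiv ℝ (fun y => k (y, s)) y w').integrable_of_hasCompactSupport
                ((hcs'.fderiv (𝕜 := ℝ)).comp_left (g := fun A : ((ℝ ∙ e)ᗮ) →L[ℝ] ℝ => A w') (by simp)))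
            (by
              simp only [one_mul]
              exact hks'.continuous.integrable_of_hasCompactSupport hcs')
            (fun x _ => differentiableAt_const _) (fun x _ => hks'.differentiable one_ne_zero x)
          simpa using this
        · rw [← Measure.prod_restrict, integral_prod _ (by
            rw [Measure.prod_restrict]; exact hBi.integrableOn)]
          rw [Measure.restrict_univ]
          refine integral_congr_ae (Eventually.of_forall fun y => ?_)
          simp only
          rw [integral_const_mul]
          congr 1
          have hks' : ContDiff ℝ 1 fun s => k (y, s) := hkc.comp (contDiff_prodMk_right y)
          have hcs' : HasCompactSupport fun s => k (y, s) :=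
            HasCompactSupport.intro (hks.isCompact.image continuous_snd) fun s hs => by
              by_contra hne
              exact hs ⟨(y, s), subset_tsupport _ hne, rfl⟩
          have hd : ∀ s, fderiv ℝ k (y, s) (0, 1) = deriv (fun s => k (y, s)) s := by
            intro s
            have := (HasFDerivAt.comp (g := k) (f := fun s => (y, s)) s (hkd (y, s))
              (hasFDerivAt_prodMk_right y s)).hasDerivAt
            rw [show (fun s => k (y, s)) = k ∘ fun s => (y, s) from rfl, this.deriv]
            simp
          simp only [hd]
          rw [← integral_Iic_eq_integral_Iio, hcs'.integral_Iic_deriv_eq hks']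
    _ = _ := by
        rw [zero_add]
        refine integral_congr_ae (Eventually.of_forall fun y => ?_)
        simp [hk, hh, hΨ, graphShear, mul_comm]

end SubgraphDivergence

/-! ### Area formula for C¹ graphs. -/

section GraphArea

open scoped NNReal ENNReal

/-- The estimate forces `F` to factor through `G` on `s`, even if `G` is not injective, and the
factor is `K`-Lipschitz. It compares a graph directly with its tangent plane, both parametrized by
`X`. -/
theorem hausdorffMeasure_image_le_of_edist_le {X Y Z : Type*} [EMetricSpace Y] [EMetricSpace Z]
    [MeasurableSpace Y] [BorelSpace Y] [MeasurableSpace Z] [BorelSpace Z] {F : X → Y} {G : X → Z}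
    {s : Set X} {K : ℝ≥0} (h : ∀ x ∈ s, ∀ y ∈ s, edist (F x) (F y) ≤ K * edist (G x) (G y))
    (d : ℕ) : μHE[d] (F '' s) ≤ (K : ℝ≥0∞) ^ d * μHE[d] (G '' s) := by
  rcases s.eq_empty_or_nonempty with rfl | ⟨x₀, hx₀⟩
  · simp
  have : Nonempty X := ⟨x₀⟩
  set B := Function.invFunOn G s with hB
  have hBs : ∀ x ∈ s, B (G x) ∈ s ∧ G (B (G x)) = G x := fun x hx =>
    ⟨Function.invFunOn_mem ⟨x, hx, rfl⟩, Function.invFunOn_eq ⟨x, hx, rfl⟩⟩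
  have him : F '' s = (F ∘ B) '' (G '' s) := by
    rw [image_image]
    refine image_congr fun x hx => ?_
    have := h x hx (B (G x)) (hBs x hx).1
    rw [(hBs x hx).2, edist_self, mul_zero, nonpos_iff_eq_zero, edist_eq_zero] at this
    exact this
  have hL : LipschitzOnWith K (F ∘ B) (G '' s) := by
    rintro _ ⟨x, hx, rfl⟩ _ ⟨y, hy, rfl⟩
    have := h _ (hBs x hx).1 _ (hBs y hy).1
    rwa [(hBs x hx).2, (hBs y hy).2] at this
  rw [him]
  simp only [Measure.euclideanHausdorffMeasure_def, Measure.smul_apply]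
  have := hL.hausdorffMeasure_image_le (d := (d : ℝ)) (by positivity)
  rw [ENNReal.rpow_natCast] at this
  calc _ ≤ _ := smul_le_smul_of_nonneg_left this zero_le
    _ = _ := by rw [mul_smul_comm]

/-- By second countability countably many of the neighbourhoods suffice; made disjoint, they give
the bound with factor `K` on every measurable set, and then `K` tends to 1. -/
theorem measure_le_of_locally_le_mul {X : Type*} [TopologicalSpace X] [SecondCountableTopology X]
    [MeasurableSpace X] [OpensMeasurableSpace X] {m₁ m₂ : Measure X}
    (h : ∀ K : ℝ≥0, 1 < K → ∀ x, ∃ U ∈ 𝓝 x, ∀ s ⊆ U, MeasurableSet s → m₁ s ≤ K * m₂ s) :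
    m₁ ≤ m₂ := by
  refine Measure.le_iff.2 fun s hs => ?_
  have key : ∀ K : ℝ≥0, 1 < K → m₁ s ≤ K * m₂ s := by
    intro K hK
    choose U hU hUs using h K hK
    obtain ⟨t, htc, ht⟩ := TopologicalSpace.countable_cover_nhds (f := fun x => interior (U x))
      (fun x => interior_mem_nhds.2 (hU x))
    rcases t.eq_empty_or_nonempty with rfl | htn
    · have : s = ∅ := by
        have h0 : (univ : Set X) = ∅ := by simpa using ht.symm
        exact eq_empty_of_subset_empty ((subset_univ s).trans h0.subset)
      simp [this]
    obtain ⟨x, rfl⟩ := htc.exists_eq_range htn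
    set D := disjointed fun n => interior (U (x n)) with hD
    have hDm : ∀ n, MeasurableSet (D n) := fun n =>
      MeasurableSet.disjointed (fun n => isOpen_interior.measurableSet) n
    have hDu : ⋃ n, D n = univ := by
      rw [hD, iUnion_disjointed, ← ht, biUnion_range]
    have hDd : Pairwise (Function.onFun Disjoint fun n => s ∩ D n) := fun i j hij =>
      ((disjoint_disjointed _) hij).mono inter_subset_right inter_subset_right
    have hsD : s = ⋃ n, s ∩ D n := by rw [← inter_iUnion, hDu, inter_univ]
    calc m₁ s = ∑' n, m₁ (s ∩ D n) := by
          conv_lhs => rw [hsD]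
          exact measure_iUnion hDd fun n => hs.inter (hDm n)
      _ ≤ ∑' n, K * m₂ (s ∩ D n) := ENNReal.tsum_le_tsum fun n =>
          hUs (x n) _ (inter_subset_right.trans ((disjointed_subset _ n).trans interior_subset))
            (hs.inter (hDm n))
      _ = K * m₂ s := by
          rw [ENNReal.tsum_mul_left]
          conv_rhs => rw [hsD]
          rw [measure_iUnion hDd fun n => hs.inter (hDm n)]
  have hlim : Tendsto (fun K : ℝ≥0 => (K : ℝ≥0∞) * m₂ s) (𝓝[>] 1) (𝓝 (1 * m₂ s)) := by
    refine ENNReal.Tendsto.mul_const ?_ (Or.inl one_ne_zero)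
    exact (ENNReal.tendsto_coe.2 tendsto_id).mono_left nhdsWithin_le_nhds
  rw [one_mul] at hlim
  exact ge_of_tendsto hlim (eventually_mem_nhdsWithin.mono fun K hK => key K hK)

variable {E : Type*} [NormedAddCommGroup E] [InnerProductSpace ℝ E] [FiniteDimensional ℝ E]
  [MeasurableSpace E] [BorelSpace E]

omit [MeasurableSpace E] [BorelSpace E] in
/-- The volume factor of the linear parametrization of a hyperplane as a graph over `eᗮ`. -/
theorem normDet_graph {e : E} (he : ‖e‖ = 1) (a : E) (hae : ⟪a, e⟫_ℝ = 0) :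
    LinearMap.normDet ((ℝ ∙ e)ᗮ.subtype
      + ((innerₛₗ ℝ a).comp (ℝ ∙ e)ᗮ.subtype).smulRight e) = ‖e - a‖ := by
  set A := (ℝ ∙ e)ᗮ.subtype + ((innerₛₗ ℝ a).comp (ℝ ∙ e)ᗮ.subtype).smulRight e with hA
  let a' : (ℝ ∙ e)ᗮ := ⟨a, Submodule.mem_orthogonal_singleton_iff_inner_left.2 hae⟩
  have hA' : ∀ u, A u = (u : E) + ⟪a, (u : E)⟫_ℝ • e := fun u => by simp [hA]
  -- A*A is the identity plus a rank-one map, so its determinant is 1 + ‖a‖², which is ‖e − a‖²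
  -- because `a` is orthogonal to the unit vector `e`.
  have h1 : LinearMap.adjoint A ∘ₗ A = LinearMap.transvection (innerₛₗ ℝ a') a' := by
    ext1 u
    refine ext_inner_right ℝ fun u' => ?_
    rw [LinearMap.comp_apply, LinearMap.adjoint_inner_left, hA', hA', LinearMap.transvection.apply]
    have h2 : ⟪(u : E), e⟫_ℝ = 0 := Submodule.mem_orthogonal_singleton_iff_inner_left.1 u.2
    have h3 : ⟪e, (u' : E)⟫_ℝ = 0 := Submodule.mem_orthogonal_singleton_iff_inner_right.1 u'.2
    simp [inner_add_left, inner_add_right, inner_smul_left, inner_smul_right, h2, h3, he, a',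
      Submodule.coe_inner, mul_comm]
  have h2 := LinearMap.normDet_sq A
  rw [h1, LinearMap.transvection.det] at h2
  rw [← sq_eq_sq₀ (LinearMap.normDet_nonneg _) (norm_nonneg _), norm_sub_sq_real,
    real_inner_comm, hae, he]
  have h3 : (innerₛₗ ℝ a') a' = ‖a‖ ^ 2 := by simp [a']
  rw [h3] at h2
  norm_num
  exact h2

/-- The parametrization of the graph of `g` over the hyperplane `eᗮ`. -/
def graphMap (e : E) (g : E → ℝ) (y : (ℝ ∙ e)ᗮ) : E := (y : E) + g y • e

omit [FiniteDimensional ℝ E] [MeasurableSpace E] [BorelSpace E] in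
theorem isClosedEmbedding_graphMap {e : E} {g : E → ℝ} (hg : Continuous g) :
    IsClosedEmbedding (graphMap e g) := by
  have hc : Continuous (graphMap e g) := by unfold graphMap; fun_prop
  have hl : Function.LeftInverse (fun x : E => (ℝ ∙ e)ᗮ.orthogonalProjectionOnto x)
      (graphMap e g) := fun y => by
    have h1 : (ℝ ∙ e)ᗮ.orthogonalProjectionOnto e = 0 := by
      rw [Submodule.orthogonalProjectionOnto_eq_zero_iff, Submodule.orthogonal_orthogonal]
      exact Submodule.mem_span_singleton_self e
    simp [graphMap, h1]
  exact hl.isClosedEmbedding (by fun_prop) hc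

/-- The area formula for `C¹` graphs. -/
theorem comap_graphMap_euclideanHausdorffMeasure {e : E} (he : ‖e‖ = 1) {g : E → ℝ}
    (hg : ContDiff ℝ 1 g) (hge : ∀ (y : E) (s : ℝ), g (y + s • e) = g y) :
    Measure.comap (graphMap e g) μHE[Module.finrank ℝ (ℝ ∙ e)ᗮ]
      = (volume : Measure (ℝ ∙ e)ᗮ).withDensity
          fun y => ENNReal.ofReal ‖e - gradient g y‖ := by
  set P := (ℝ ∙ e)ᗮ with hP
  set d := Module.finrank ℝ P with hd
  set Γ := graphMap e g with hΓ
  have hΓe : MeasurableEmbedding Γ := (isClosedEmbedding_graphMap hg.continuous).measurableEmbedding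
  set N : P → ℝ := fun y => ‖e - gradient g y‖ with hN
  have hgrad : Continuous (gradient g) := by
    unfold gradient
    exact (LinearIsometryEquiv.continuous _).comp (hg.continuous_fderiv one_ne_zero)
  have hNc : Continuous N := by fun_prop
  have hge0 : ∀ y, ⟪gradient g y, e⟫_ℝ = 0 := fun y => by
    rw [inner_gradient_left, fderiv_apply_eq_zero_of_const_along hg hge]
  have hN1 : ∀ y, 1 ≤ N y := fun y => by
    have : 1 ≤ N y ^ 2 := by
      simp only [hN]
      rw [norm_sub_sq_real, real_inner_comm, hge0, he]
      nlinarith [sq_nonneg ‖gradient g (y : E)‖]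
    nlinarith [norm_nonneg (e - gradient g (y : E)), this]
  let A : P → P →ₗ[ℝ] E := fun y => P.subtype
      + ((innerₛₗ ℝ (gradient g y)).comp P.subtype).smulRight e
  have hA : ∀ y u, A y u = (u : E) + ⟪gradient g (y : E), (u : E)⟫_ℝ • e := fun y u => by simp [A]
  have hAn : ∀ y s, μHE[d] (A y '' s) = ENNReal.ofReal (N y) * volume s := fun y s => by
    rw [LinearMap.euclideanHausdorffMeasure_image_eq_normDet_mul_volume, normDet_graph he _ (hge0 y)]
  -- The tangent map does not shorten vectors, so an error c‖x − x'‖ is at most c‖A y (x − x')‖, a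
  -- relative error.
  have hAl : ∀ y u, ‖u‖ ≤ ‖A y u‖ := fun y u => by
    have h2 : ⟪(u : E), e⟫_ℝ = 0 := Submodule.mem_orthogonal_singleton_iff_inner_left.1 u.2
    have : ‖u‖ ^ 2 ≤ ‖A y u‖ ^ 2 := by
      rw [hA, norm_add_sq_real, inner_smul_right, h2]
      simp only [Submodule.coe_norm]
      nlinarith [sq_nonneg ‖⟪gradient g (y : E), (u : E)⟫_ℝ • e‖]
    exact (sq_le_sq₀ (norm_nonneg _) (norm_nonneg _)).1 this
  have hstrict : ∀ y, HasStrictFDerivAt Γ (A y).toContinuousLinearMap y := fun y => by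
    have h1 : HasStrictFDerivAt (fun y : P => (y : E)) P.subtypeL y := P.subtypeL.hasStrictFDerivAt
    have h2 : HasStrictFDerivAt (fun y : P => g y) ((fderiv ℝ g y).comp P.subtypeL) y :=
      ((hg.contDiffAt).hasStrictFDerivAt one_ne_zero).comp y h1
    have h3 := h1.add (h2.smul_const e)
    have h4 : (A y).toContinuousLinearMap
        = P.subtypeL + ((fderiv ℝ g y).comp P.subtypeL).smulRight e := by
      ext u
      simp [A]
    rw [h4]
    exact h3
  -- Strict differentiability controls differences between any two points near y, not only
  -- differences from y.
  have hlow : ∀ c : ℝ≥0, 0 < c → ∀ y, ∃ U ∈ 𝓝 y, (∀ x ∈ U, ∀ x' ∈ U,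
      ‖Γ x - Γ x' - A y (x - x')‖ ≤ c * ‖x - x'‖) ∧
      ∀ x ∈ U, N x ≤ (1 + c) * N y ∧ N y ≤ (1 + c) * N x := fun c hc y => by
    obtain ⟨U, hU, hUa⟩ := (hstrict y).approximates_deriv_on_nhds (c := c) (Or.inr hc)
    have h1 : ∀ᶠ x in 𝓝 y, N x < (1 + c) * N y ∧ N y < (1 + c) * N x := by
      have hpos : 0 < (c : ℝ) := hc
      refine ((hNc.tendsto y).eventually_lt_const ?_).and
        ((tendsto_const_nhds.mul (hNc.tendsto y)).eventually_const_lt ?_) <;>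
        nlinarith [hN1 y]
    exact ⟨_, inter_mem hU h1, fun x hx x' hx' => hUa x hx.1 x' hx'.1,
      fun x hx => ⟨hx.2.1.le, hx.2.2.le⟩⟩
  have hdens : ∀ s, MeasurableSet s → (volume.withDensity fun y => ENNReal.ofReal (N y)) s
      = ∫⁻ y in s, ENNReal.ofReal (N y) := fun s hs => withDensity_apply _ hs
  -- The two products are the total losses in the two inequalities: a power `d` from the Lipschitz
  -- comparison of graph and tangent plane, and one factor 1 + c from the oscillation of the density
  -- `N`.
  have hsmall : ∀ K : ℝ≥0, 1 < K → ∃ c : ℝ≥0, 0 < c ∧ c < 1 ∧ (1 + c) ^ d * (1 + c) ≤ K ∧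
      (1 + c) * ((1 - c)⁻¹) ^ d ≤ K := fun K hK => by
    have h1 : Tendsto (fun c : ℝ≥0 => (1 + c) ^ d * (1 + c)) (𝓝[>] 0) (𝓝 1) := by
      have : Continuous fun c : ℝ≥0 => (1 + c) ^ d * (1 + c) := by fun_prop
      simpa using (this.tendsto 0).mono_left nhdsWithin_le_nhds
    have h2 : Tendsto (fun c : ℝ≥0 => (1 + c) * ((1 - c)⁻¹) ^ d) (𝓝[>] 0) (𝓝 1) := by
      have : ContinuousAt (fun c : ℝ≥0 => (1 + c) * ((1 - c)⁻¹) ^ d) 0 := by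
        refine ContinuousAt.mul (by fun_prop) (ContinuousAt.pow (ContinuousAt.inv₀ ?_ (by simp)) d)
        fun_prop
      simpa using this.tendsto.mono_left nhdsWithin_le_nhds
    have h3 : ∀ᶠ c : ℝ≥0 in 𝓝[>] 0, c < 1 :=
      nhdsWithin_le_nhds (gt_mem_nhds zero_lt_one)
    obtain ⟨c, hc⟩ := (((h1.eventually_le_const hK).and (h2.eventually_le_const hK)).and
      (h3.and eventually_mem_nhdsWithin)).exists
    exact ⟨c, hc.2.2, hc.2.1, hc.1.1, hc.1.2⟩
  have hmeas : Measurable fun y => ENNReal.ofReal (N y) := hNc.measurable.ennreal_ofReal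
  refine le_antisymm (measure_le_of_locally_le_mul fun K hK y => ?_)
    (measure_le_of_locally_le_mul fun K hK y => ?_)
  · obtain ⟨c, hc0, hc1, hcK, -⟩ := hsmall K hK
    obtain ⟨U, hU, hU1, hU2⟩ := hlow c hc0 y
    refine ⟨U, hU, fun s hsU hs => ?_⟩
    rw [hΓe.comap_apply, hdens s hs]
    calc μHE[d] (Γ '' s) ≤ ((1 + c : ℝ≥0) : ℝ≥0∞) ^ d * μHE[d] (A y '' s) := by
          refine hausdorffMeasure_image_le_of_edist_le (fun x hx x' hx' => ?_) d
          rw [edist_nndist, edist_nndist, ← ENNReal.coe_mul, ENNReal.coe_le_coe,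
            ← NNReal.coe_le_coe]
          push_cast
          rw [dist_eq_norm, dist_eq_norm, ← map_sub]
          have h4 := hU1 x (hsU hx) x' (hsU hx')
          have h5 := norm_add_le (Γ x - Γ x' - A y (x - x')) (A y (x - x'))
          rw [sub_add_cancel] at h5
          have h6 := hAl y (x - x')
          nlinarith [c.2, mul_le_mul_of_nonneg_left h6 c.2]
      _ = ((1 + c : ℝ≥0) : ℝ≥0∞) ^ d * ∫⁻ x in s, ENNReal.ofReal (N y) := by
          rw [hAn, setLIntegral_const]
      _ ≤ ((1 + c : ℝ≥0) : ℝ≥0∞) ^ d * ∫⁻ x in s, (1 + c : ℝ≥0) * ENNReal.ofReal (N x) := by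
          refine mul_le_mul_right ?_ _
          refine setLIntegral_mono (hmeas.const_mul _) fun x hx => ?_
          rw [← ENNReal.ofReal_coe_nnreal, ← ENNReal.ofReal_mul (by positivity)]
          exact ENNReal.ofReal_le_ofReal (hU2 x (hsU hx)).2
      _ = (((1 + c) ^ d * (1 + c) : ℝ≥0) : ℝ≥0∞) * ∫⁻ x in s, ENNReal.ofReal (N x) := by
          rw [lintegral_const_mul _ hmeas, ← mul_assoc]
          push_cast
          rfl
      _ ≤ _ := by gcongr
  · obtain ⟨c, hc0, hc1, -, hcK⟩ := hsmall K hK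
    obtain ⟨U, hU, hU1, hU2⟩ := hlow c hc0 y
    refine ⟨U, hU, fun s hsU hs => ?_⟩
    rw [hΓe.comap_apply, hdens s hs]
    calc ∫⁻ x in s, ENNReal.ofReal (N x)
        ≤ ∫⁻ x in s, ((1 + c : ℝ≥0) : ℝ≥0∞) * ENNReal.ofReal (N y) := by
          refine setLIntegral_mono measurable_const fun x hx => ?_
          rw [← ENNReal.ofReal_coe_nnreal, ← ENNReal.ofReal_mul (by positivity)]
          exact ENNReal.ofReal_le_ofReal (hU2 x (hsU hx)).1
      _ = ((1 + c : ℝ≥0) : ℝ≥0∞) * μHE[d] (A y '' s) := by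
          rw [hAn, setLIntegral_const, mul_assoc]
      _ ≤ ((1 + c : ℝ≥0) : ℝ≥0∞) * ((((1 - c)⁻¹ : ℝ≥0) : ℝ≥0∞) ^ d * μHE[d] (Γ '' s)) := by
          gcongr
          refine hausdorffMeasure_image_le_of_edist_le (fun x hx x' hx' => ?_) d
          rw [edist_nndist, edist_nndist, ← ENNReal.coe_mul, ENNReal.coe_le_coe,
            inv_mul_eq_div, le_div_iff₀ (tsub_pos_of_lt hc1), ← NNReal.coe_le_coe]
          rw [NNReal.coe_mul, NNReal.coe_sub hc1.le, coe_nndist, coe_nndist, NNReal.coe_one,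
            dist_eq_norm, dist_eq_norm, ← map_sub]
          have h4 := hU1 x (hsU hx) x' (hsU hx')
          have h5 := norm_sub_le (Γ x - Γ x') (Γ x - Γ x' - A y (x - x'))
          rw [sub_sub_cancel] at h5
          have h6 := hAl y (x - x')
          nlinarith [c.2, mul_le_mul_of_nonneg_left h6 c.2]
      _ = (((1 + c) * (1 - c)⁻¹ ^ d : ℝ≥0) : ℝ≥0∞) * μHE[d] (Γ '' s) := by
          rw [← mul_assoc, ENNReal.coe_mul, ENNReal.coe_pow]
      _ ≤ _ := by gcongr

theorem restrict_range_graphMap_euclideanHausdorffMeasure {e : E} (he : ‖e‖ = 1) {g : E → ℝ}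
    (hg : ContDiff ℝ 1 g) (hge : ∀ (y : E) (s : ℝ), g (y + s • e) = g y) :
    (μHE[Module.finrank ℝ (ℝ ∙ e)ᗮ] : Measure E).restrict (range (graphMap e g))
      = ((volume : Measure (ℝ ∙ e)ᗮ).withDensity
          fun y => ENNReal.ofReal ‖e - gradient g y‖).map (graphMap e g) := by
  rw [← comap_graphMap_euclideanHausdorffMeasure he hg hge,
    (isClosedEmbedding_graphMap hg.continuous).measurableEmbedding.map_comap]

end GraphArea

/-! ### Local structure of C¹ domains and the outer normal. -/

section C1Domain

theorem contDiff_of_forall_mem_tsupport {E F : Type*} [NormedAddCommGroup E] [NormedSpace ℝ E]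
    [NormedAddCommGroup F] [NormedSpace ℝ F] {m : WithTop ℕ∞} {f : E → F}
    (h : ∀ x ∈ tsupport f, ContDiffAt ℝ m f x) : ContDiff ℝ m f := by
  refine contDiff_iff_contDiffAt.2 fun x => ?_
  by_cases hx : x ∈ tsupport f
  · exact h x hx
  · exact contDiffAt_const.congr_of_eventuallyEq (notMem_tsupport_iff_eventuallyEq.1 hx)

variable {n : ℕ} {U : Set (EuclideanSpace ℝ (Fin n))} {x₀ e : EuclideanSpace ℝ (Fin n)}
  {g : EuclideanSpace ℝ (Fin n) → ℝ}

namespace IsLocalSubgraph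

theorem inner_gradient_eq_zero (h : IsLocalSubgraph U x₀ e g) : ⟪e, gradient g x₀⟫_ℝ = 0 := by
  rw [inner_gradient_right]
  have h1 : HasLineDerivAt ℝ g (fderiv ℝ g x₀ e) x₀ e :=
    (h.contDiffAt.differentiableAt one_ne_zero).hasFDerivAt.hasLineDerivAt e
  have h2 : HasLineDerivAt ℝ g 0 x₀ e := by
    unfold HasLineDerivAt
    simp only [h.const_along]
    exact hasDerivAt_const _ _
  exact HasDerivAt.unique h1 h2

theorem sub_gradient_ne_zero (h : IsLocalSubgraph U x₀ e g) : e - gradient g x₀ ≠ 0 := by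
  intro h0
  have h1 : ⟪e, e - gradient g x₀⟫_ℝ = 1 := by
    rw [inner_sub_right, h.inner_gradient_eq_zero, real_inner_self_eq_norm_sq, h.norm_eq_one]
    norm_num
  rw [h0, inner_zero_right] at h1
  exact zero_ne_one h1

theorem eventually (h : IsLocalSubgraph U x₀ e g) : ∀ᶠ x in 𝓝 x₀, IsLocalSubgraph U x e g := by
  filter_upwards [h.contDiffAt.eventually (by simp), h.mem_iff.eventually_nhds] with x h1 h2
  exact ⟨h.norm_eq_one, h1, h.const_along, h2⟩

theorem mem_frontier_iff (hU : IsOpen U) (h : IsLocalSubgraph U x₀ e g) :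
    x₀ ∈ frontier U ↔ ⟪e, x₀⟫_ℝ = g x₀ := by
  have hiff := h.mem_iff.self_of_nhds
  rw [hU.frontier_eq]
  constructor
  · rintro ⟨hc, hn⟩
    rw [hiff, not_lt] at hn
    refine le_antisymm ?_ hn
    by_contra! hlt
    have h1 : ∀ᶠ x in 𝓝 x₀, g x < ⟪e, x⟫_ℝ :=
      h.contDiffAt.continuousAt.eventually_lt (by fun_prop) hlt
    obtain ⟨x, hxU, hx1, hx2⟩ := (mem_closure_iff_frequently.1 hc).and_eventually
      (h1.and h.mem_iff) |>.exists
    exact lt_asymm hx1 (hx2.1 hxU)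
  · intro heq
    refine ⟨?_, fun hx => absurd heq (hiff.1 hx).ne⟩
    -- Moving from `x₀` against `e` leaves `g` unchanged and lowers the height, so these points lie
    -- in `U` and converge to `x₀`.
    have ht : Tendsto (fun s : ℝ => x₀ + (-s) • e) (𝓝[>] 0) (𝓝 x₀) := by
      have : Continuous fun s : ℝ => x₀ + (-s) • e := by fun_prop
      simpa using (this.tendsto 0).mono_left nhdsWithin_le_nhds
    refine mem_closure_of_tendsto ht ?_
    filter_upwards [ht.eventually h.mem_iff, self_mem_nhdsWithin] with s hs hs0
    rw [hs, h.const_along, inner_add_right, inner_smul_right, real_inner_self_eq_norm_sq,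
      h.norm_eq_one, heq]
    have : (0 : ℝ) < s := hs0
    linarith

/-- A direction pointing strictly into the first subgraph enters `U`, hence also the second
subgraph, whose defining function then has nonpositive difference quotients. Applied to two
representations of `U`, it nests their inner half-spaces. -/
theorem inner_sub_gradient_nonpos {e' : EuclideanSpace ℝ (Fin n)}
    {g' : EuclideanSpace ℝ (Fin n) → ℝ} (hU : IsOpen U) (hx : x₀ ∈ frontier U)
    (h : IsLocalSubgraph U x₀ e g) (h' : IsLocalSubgraph U x₀ e' g')
    {w : EuclideanSpace ℝ (Fin n)} (hw : ⟪e - gradient g x₀, w⟫_ℝ < 0) :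
    ⟪e' - gradient g' x₀, w⟫_ℝ ≤ 0 := by
  have key : ∀ {e g}, IsLocalSubgraph U x₀ e g → Tendsto
      (fun s : ℝ => s⁻¹ • (⟪e, x₀ + s • w⟫_ℝ - g (x₀ + s • w))) (𝓝[>] 0)
      (𝓝 ⟪e - gradient g x₀, w⟫_ℝ) := by
    intro e g h
    have h1 : HasFDerivAt (fun y => ⟪e, y⟫_ℝ - g y) (innerSL ℝ e - fderiv ℝ g x₀) x₀ :=
      (innerSL ℝ e).hasFDerivAt.sub (h.contDiffAt.differentiableAt one_ne_zero).hasFDerivAt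
    have h2 : HasDerivAt (fun s : ℝ => ⟪e, x₀ + s • w⟫_ℝ - g (x₀ + s • w))
        ((innerSL ℝ e - fderiv ℝ g x₀) w) 0 := h1.hasLineDerivAt w
    have h3 := h2.tendsto_slope_zero_right
    have h4 := (h.mem_frontier_iff hU).1 hx
    simp only [zero_add, zero_smul, add_zero, h4, sub_self, sub_zero] at h3
    convert! h3 using 2
    rw [inner_sub_left, inner_gradient_left]
    simp
  have ht : Tendsto (fun s : ℝ => x₀ + s • w) (𝓝[>] 0) (𝓝 x₀) := by
    have : Continuous fun s : ℝ => x₀ + s • w := by fun_prop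
    simpa using (this.tendsto 0).mono_left nhdsWithin_le_nhds
  refine le_of_tendsto (key h') ?_
  filter_upwards [ht.eventually h.mem_iff, ht.eventually h'.mem_iff, self_mem_nhdsWithin,
    (key h).eventually_lt_const hw] with s h1 h2 hs0 h3
  have hs : (0 : ℝ) < s := hs0
  have h4 : ⟪e, x₀ + s • w⟫_ℝ - g (x₀ + s • w) < 0 := by
    by_contra! hc
    exact absurd h3 (not_lt.2 (smul_nonneg (inv_nonneg.2 hs.le) hc))
  have h5 := h2.1 (h1.2 (by linarith))
  exact smul_nonpos_of_nonneg_of_nonpos (inv_nonneg.2 hs.le) (by linarith)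

/-- The unit outer normal does not depend on the local representation as a subgraph. -/
theorem normal_unique {e' : EuclideanSpace ℝ (Fin n)}
    {g' : EuclideanSpace ℝ (Fin n) → ℝ} (hU : IsOpen U) (hx : x₀ ∈ frontier U)
    (h : IsLocalSubgraph U x₀ e g) (h' : IsLocalSubgraph U x₀ e' g') :
    ‖e - gradient g x₀‖⁻¹ • (e - gradient g x₀)
      = ‖e' - gradient g' x₀‖⁻¹ • (e' - gradient g' x₀) := by
  set N := e - gradient g x₀ with hN
  set N' := e' - gradient g' x₀ with hN'
  have hN0 : 0 < ‖N‖ := norm_pos_iff.2 h.sub_gradient_ne_zero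
  have hN0' : 0 < ‖N'‖ := norm_pos_iff.2 h'.sub_gradient_ne_zero
  have h1 : ‖‖N‖⁻¹ • N‖ = 1 := norm_smul_inv_norm h.sub_gradient_ne_zero
  have h1' : ‖‖N'‖⁻¹ • N'‖ = 1 := norm_smul_inv_norm h'.sub_gradient_ne_zero
  set a := ‖N‖⁻¹ • N with ha
  set b := ‖N'‖⁻¹ • N' with hb
  have hNa : N = ‖N‖ • a := by rw [ha, smul_smul, mul_inv_cancel₀ hN0.ne', one_smul]
  have hNb : N' = ‖N'‖ • b := by rw [hb, smul_smul, mul_inv_cancel₀ hN0'.ne', one_smul]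
  have haa : ⟪a, a⟫_ℝ = 1 := by rw [real_inner_self_eq_norm_sq, h1]; norm_num
  have hbb : ⟪b, b⟫_ℝ = 1 := by rw [real_inner_self_eq_norm_sq, h1']; norm_num
  -- If the unit normals `a`, `b` differed, the vector b − a would point strictly inwards for `a`
  -- and strictly outwards for `b`.
  have hab : 1 ≤ ⟪a, b⟫_ℝ := by
    by_contra! hlt
    have h2 : ⟪N, b - a⟫_ℝ < 0 := by
      rw [hNa, real_inner_smul_left, inner_sub_right, haa]
      exact mul_neg_of_pos_of_neg hN0 (by linarith)
    have h3 := inner_sub_gradient_nonpos hU hx h h' h2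
    rw [← hN', hNb, real_inner_smul_left, inner_sub_right, hbb, real_inner_comm] at h3
    have : 0 < ‖N'‖ * (1 - ⟪a, b⟫_ℝ) := mul_pos hN0' (by linarith)
    linarith
  have hab' : ⟪a, b⟫_ℝ = 1 := by
    refine le_antisymm ?_ hab
    have := real_inner_le_norm a b
    rwa [h1, h1', one_mul] at this
  exact (inner_eq_one_iff_of_norm_eq_one h1 h1').1 hab'

/-- The local graph function may be taken globally `C¹`. -/
theorem exists_contDiff (h : IsLocalSubgraph U x₀ e g) :
    ∃ g' : EuclideanSpace ℝ (Fin n) → ℝ, ContDiff ℝ 1 g' ∧ IsLocalSubgraph U x₀ e g' := by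
  obtain ⟨r, hr, hball⟩ := Metric.eventually_nhds_iff_ball.1 (h.contDiffAt.eventually (by simp))
  let θ : ContDiffBump x₀ := ⟨r / 3, r / 2, by positivity, by linarith⟩
  -- A cut-off of `g` alone would depend on the coordinate along `e`; composing with the projection
  -- to the hyperplane through `x₀` orthogonal to `e` restores constancy along `e`.
  let π : EuclideanSpace ℝ (Fin n) → EuclideanSpace ℝ (Fin n) := fun x => x + (-⟪e, x - x₀⟫_ℝ) • e
  have hπ : ContDiff ℝ 1 π := by
    have h1 : ContDiff ℝ 1 fun x : EuclideanSpace ℝ (Fin n) => ⟪e, x - x₀⟫_ℝ :=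
      contDiff_const.inner ℝ (contDiff_id.sub contDiff_const)
    exact contDiff_id.add (h1.neg.smul contDiff_const)
  have hθg : ContDiff ℝ 1 fun x => θ x * g x := by
    refine contDiff_of_forall_mem_tsupport fun x hx => ?_
    have hx' : x ∈ tsupport θ := closure_mono (Function.support_mul_subset_left _ _) hx
    rw [θ.tsupport_eq] at hx'
    exact θ.contDiff.contDiffAt.mul (hball x (Metric.closedBall_subset_ball (by
      show r / 2 < r
      linarith) hx'))
  have hπ0 : π x₀ = x₀ := by simp [π]
  have heq : (fun x => θ (π x) * g (π x)) =ᶠ[𝓝 x₀] g := by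
    have h1 : Tendsto π (𝓝 x₀) (𝓝 x₀) := by
      have := hπ.continuous.tendsto x₀
      rwa [hπ0] at this
    filter_upwards [h1.eventually θ.eventuallyEq_one] with x hx
    rw [hx, Pi.one_apply, one_mul]
    exact h.const_along _ _
  refine ⟨fun x => θ (π x) * g (π x), hθg.comp hπ, h.norm_eq_one, (hθg.comp hπ).contDiffAt, ?_, ?_⟩
  · intro y s
    have : π (y + s • e) = π y := by
      simp only [π]
      rw [add_sub_right_comm, inner_add_right, inner_smul_right, real_inner_self_eq_norm_sq,
        h.norm_eq_one, add_assoc, ← add_smul]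
      congr 2
      ring
    simp only [this]
  · filter_upwards [h.mem_iff, heq] with x h1 h2
    rw [h1, h2]

end IsLocalSubgraph

theorem IsOuterUnitNormal.eq_of_isLocalSubgraph {ν : EuclideanSpace ℝ (Fin n)} (hU : IsOpen U)
    (hx : x₀ ∈ frontier U) (hν : IsOuterUnitNormal U x₀ ν) (h : IsLocalSubgraph U x₀ e g) :
    ν = ‖e - gradient g x₀‖⁻¹ • (e - gradient g x₀) := by
  obtain ⟨e', g', h', rfl⟩ := hν
  exact h'.normal_unique hU hx h

theorem range_graphMap (he : ‖e‖ = 1) (hge : ∀ y, ∀ s : ℝ, g (y + s • e) = g y) :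
    range (graphMap e g) = {x | ⟪e, x⟫_ℝ = g x} := by
  ext x
  constructor
  · rintro ⟨y, rfl⟩
    show ⟪e, graphMap e g y⟫_ℝ = g (graphMap e g y)
    rw [graphMap, hge, inner_add_right, inner_smul_right, inner_coe_orthogonal_singleton,
      real_inner_self_eq_norm_sq, he]
    ring
  · intro hx
    have hx' : ⟪e, x⟫_ℝ = g x := hx
    refine ⟨⟨x + (-⟪e, x⟫_ℝ) • e, Submodule.mem_orthogonal_singleton_iff_inner_right.2 (by
      rw [inner_add_right, inner_smul_right, real_inner_self_eq_norm_sq, he]; ring)⟩, ?_⟩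
    rw [graphMap]
    simp only
    rw [hge, ← hx', add_assoc, ← add_smul]
    simp

theorem gradient_add_smul (hge : ∀ y, ∀ s : ℝ, g (y + s • e) = g y)
    (y : EuclideanSpace ℝ (Fin n)) (s : ℝ) : gradient g (y + s • e) = gradient g y := by
  unfold gradient
  rw [← fderiv_comp_add_right]
  simp only [hge]

theorem finrank_orthogonal_singleton (he : ‖e‖ = 1) :
    Module.finrank ℝ (ℝ ∙ e)ᗮ = n - 1 := by
  have he0 : e ≠ 0 := by intro h; simp [h] at he
  have h1 := (ℝ ∙ e).finrank_add_finrank_orthogonal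
  rw [finrank_span_singleton he0, finrank_euclideanSpace_fin] at h1
  omega

/-- The divergence theorem for functions supported near a boundary point. -/
theorem IsLocalSubgraph.exists_integral_fderiv_eq (hU : IsOpen U)
    (h : IsLocalSubgraph U x₀ e g) (hg : ContDiff ℝ 1 g)
    {ν : EuclideanSpace ℝ (Fin n) → EuclideanSpace ℝ (Fin n)}
    (hν : ∀ x ∈ frontier U, IsOuterUnitNormal U x (ν x)) :
    ∃ r > 0, μHE[n - 1] (frontier U ∩ Metric.ball x₀ r) < ⊤ ∧
      ContinuousOn ν (frontier U ∩ Metric.ball x₀ r) ∧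
      ∀ f : EuclideanSpace ℝ (Fin n) → ℝ, ContDiff ℝ 1 f → HasCompactSupport f →
        tsupport f ⊆ Metric.ball x₀ r → ∀ w, ∫ x in U, fderiv ℝ f x w
          = ∫ x in frontier U, f x * ⟪ν x, w⟫_ℝ ∂μHE[n - 1] := by
  have he := h.norm_eq_one
  have hge := h.const_along
  obtain ⟨r, hr, hball⟩ := Metric.eventually_nhds_iff_ball.1 h.eventually
  set Γ := graphMap e g with hΓ
  have hΓc : IsClosedEmbedding Γ := isClosedEmbedding_graphMap hg.continuous
  have hrange := range_graphMap he hge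
  have hgrad : Continuous (gradient g) := by
    unfold gradient
    exact (LinearIsometryEquiv.continuous _).comp (hg.continuous_fderiv one_ne_zero)
  have hN0 : ∀ x, e - gradient g x ≠ 0 := fun x h0 => by
    have h1 : ⟪e, e - gradient g x⟫_ℝ = 1 := by
      rw [inner_sub_right, inner_gradient_right, fderiv_apply_eq_zero_of_const_along hg hge,
        real_inner_self_eq_norm_sq, he]
      norm_num
    rw [h0, inner_zero_right] at h1
    exact zero_ne_one h1
  have hfr : ∀ x ∈ Metric.ball x₀ r, (x ∈ frontier U ↔ x ∈ range Γ) := fun x hx => by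
    rw [(hball x hx).mem_frontier_iff hU, hrange]
    rfl
  have hνeq : ∀ x ∈ frontier U ∩ Metric.ball x₀ r,
      ν x = ‖e - gradient g x‖⁻¹ • (e - gradient g x) := fun x hx =>
    (hν x hx.1).eq_of_isLocalSubgraph hU hx.1 (hball x hx.2)
  have hmeas := restrict_range_graphMap_euclideanHausdorffMeasure he hg hge
  rw [finrank_orthogonal_singleton he] at hmeas
  refine ⟨r, hr, ?_, ?_, ?_⟩
  · calc μHE[n - 1] (frontier U ∩ Metric.ball x₀ r)
        ≤ μHE[n - 1].restrict (range Γ) (Metric.closedBall x₀ r) := by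
          rw [Measure.restrict_apply Metric.isClosed_closedBall.measurableSet]
          exact measure_mono fun x hx =>
            ⟨Metric.ball_subset_closedBall hx.2, (hfr x hx.2).1 hx.1⟩
      _ = ∫⁻ y in Γ ⁻¹' Metric.closedBall x₀ r, ENNReal.ofReal ‖e - gradient g y‖ := by
          rw [hmeas, hΓc.measurableEmbedding.map_apply, withDensity_apply _
            (hΓc.continuous.measurable Metric.isClosed_closedBall.measurableSet)]
      _ < ⊤ := by
          have hK : IsCompact (Γ ⁻¹' Metric.closedBall x₀ r) :=
            hΓc.isCompact_preimage (isCompact_closedBall x₀ r)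
          have hc : Continuous fun y : (ℝ ∙ e)ᗮ => ‖e - gradient g y‖ := by fun_prop
          have hi := (hc.continuousOn.integrableOn_compact hK (μ := volume)).2
          rw [hasFiniteIntegral_iff_ofReal (Eventually.of_forall fun y => norm_nonneg _)] at hi
          exact hi
  · refine ContinuousOn.congr (Continuous.continuousOn ?_) hνeq
    exact (Continuous.inv₀ (by fun_prop) fun x => norm_ne_zero_iff.2 (hN0 x)).smul (by fun_prop)
  · intro f hf hfc hfs w
    have hsupp : ∀ x, x ∉ Metric.ball x₀ r → f x = 0 := fun x hx =>
      image_eq_zero_of_notMem_tsupport fun hx' => hx (hfs hx')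
    have hsupp' : ∀ x, x ∉ Metric.ball x₀ r → fderiv ℝ f x = 0 := fun x hx =>
      image_eq_zero_of_notMem_tsupport fun hx' => hx (hfs (tsupport_fderiv_subset ℝ hx'))
    have hsub : MeasurableSet {x : EuclideanSpace ℝ (Fin n) | ⟪e, x⟫_ℝ < g x} :=
      measurableSet_lt (by fun_prop) hg.continuous.measurable
    calc ∫ x in U, fderiv ℝ f x w = ∫ x in {x | ⟪e, x⟫_ℝ < g x}, fderiv ℝ f x w := by
          rw [← integral_indicator hU.measurableSet, ← integral_indicator hsub]
          congr 1
          ext x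
          by_cases hx : x ∈ Metric.ball x₀ r
          · have := (hball x hx).mem_iff.self_of_nhds
            by_cases hxU : x ∈ U
            · rw [indicator_of_mem hxU, indicator_of_mem
                (show x ∈ {x | ⟪e, x⟫_ℝ < g x} from this.1 hxU)]
            · rw [indicator_of_notMem hxU, indicator_of_notMem
                (show x ∉ {x | ⟪e, x⟫_ℝ < g x} from fun h => hxU (this.2 h))]
          · simp [indicator_apply, hsupp' x hx]
      _ = ∫ y : (ℝ ∙ e)ᗮ, ‖e - gradient g y‖ * (f (Γ y) *
            ⟪‖e - gradient g (Γ y)‖⁻¹ • (e - gradient g (Γ y)), w⟫_ℝ) := by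
          -- The factor (e, w) − ∂g(w) equals ‖e − ∇g‖ (ν, w), and ‖e − ∇g‖ is the density of
          -- surface measure in graph coordinates.
          rw [integral_subgraph_fderiv he hg hge hf hfc w]
          refine integral_congr_ae (Eventually.of_forall fun y => ?_)
          simp only
          rw [hΓ, graphMap, gradient_add_smul hge, real_inner_smul_left, inner_sub_left,
            inner_gradient_left]
          have hne := norm_ne_zero_iff.2 (hN0 y)
          field_simp
      _ = ∫ x in range Γ, f x * ⟪‖e - gradient g x‖⁻¹ • (e - gradient g x), w⟫_ℝ
            ∂μHE[n - 1] := by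
          rw [hmeas, hΓc.measurableEmbedding.integral_map,
            integral_withDensity_eq_integral_toReal_smul]
          · simp only [ENNReal.toReal_ofReal (norm_nonneg _), smul_eq_mul]
          · exact (by fun_prop : Continuous fun y : (ℝ ∙ e)ᗮ =>
              ‖e - gradient g y‖).measurable.ennreal_ofReal
          · exact Eventually.of_forall fun y => ENNReal.ofReal_lt_top
      _ = ∫ x in frontier U, f x * ⟪ν x, w⟫_ℝ ∂μHE[n - 1] := by
          rw [← integral_indicator hΓc.isClosed_range.measurableSet,
            ← integral_indicator isClosed_frontier.measurableSet]
          congr 1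
          ext x
          by_cases hx : x ∈ Metric.ball x₀ r
          · by_cases hxU : x ∈ frontier U
            · rw [indicator_of_mem hxU, indicator_of_mem ((hfr x hx).1 hxU), hνeq x ⟨hxU, hx⟩]
            · rw [indicator_of_notMem hxU, indicator_of_notMem (fun h => hxU ((hfr x hx).2 h))]
          · simp only [indicator, hsupp x hx, zero_mul, ite_self]

end C1Domain

/-! ### Divergence theorem on a bounded C¹ domain. -/

section DivergenceTheorem

variable {n : ℕ} {U : Set (EuclideanSpace ℝ (Fin n))}
  {ν : EuclideanSpace ℝ (Fin n) → EuclideanSpace ℝ (Fin n)}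

namespace IsBoundedC1Domain

theorem isCompact_closure (hU : IsBoundedC1Domain U) : IsCompact (closure U) :=
  hU.isBounded.isCompact_closure

theorem isCompact_frontier (hU : IsBoundedC1Domain U) : IsCompact (frontier U) :=
  hU.isCompact_closure.of_isClosed_subset isClosed_frontier frontier_subset_closure

theorem exists_integral_fderiv_eq (hU : IsBoundedC1Domain U)
    (hν : ∀ x ∈ frontier U, IsOuterUnitNormal U x (ν x))
    {x₀ : EuclideanSpace ℝ (Fin n)} (hx₀ : x₀ ∈ frontier U) :
    ∃ r > 0, μHE[n - 1] (frontier U ∩ Metric.ball x₀ r) < ⊤ ∧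
      ContinuousOn ν (frontier U ∩ Metric.ball x₀ r) ∧
      ∀ f : EuclideanSpace ℝ (Fin n) → ℝ, ContDiff ℝ 1 f → HasCompactSupport f →
        tsupport f ⊆ Metric.ball x₀ r → ∀ w, ∫ x in U, fderiv ℝ f x w
          = ∫ x in frontier U, f x * ⟪ν x, w⟫_ℝ ∂μHE[n - 1] := by
  obtain ⟨e, g, h⟩ := hU.boundary x₀ hx₀
  obtain ⟨g', hg', h'⟩ := h.exists_contDiff
  exact h'.exists_integral_fderiv_eq hU.isOpen hg' hν

theorem continuousOn_normal (hU : IsBoundedC1Domain U)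
    (hν : ∀ x ∈ frontier U, IsOuterUnitNormal U x (ν x)) : ContinuousOn ν (frontier U) := by
  intro x hx
  obtain ⟨r, hr, -, hc, -⟩ := hU.exists_integral_fderiv_eq hν hx
  exact (continuousWithinAt_inter (Metric.ball_mem_nhds x hr)).1
    (hc x ⟨hx, Metric.mem_ball_self hr⟩)

theorem euclideanHausdorffMeasure_frontier_lt_top (hU : IsBoundedC1Domain U)
    (hν : ∀ x ∈ frontier U, IsOuterUnitNormal U x (ν x)) : μHE[n - 1] (frontier U) < ⊤ := by
  refine hU.isCompact_frontier.measure_lt_top_of_nhdsWithin fun x hx => ?_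
  obtain ⟨r, hr, hfin, -, -⟩ := hU.exists_integral_fderiv_eq hν hx
  exact ⟨_, inter_mem_nhdsWithin _ (Metric.ball_mem_nhds x hr), hfin⟩

theorem integrableOn_frontier (hU : IsBoundedC1Domain U)
    (hν : ∀ x ∈ frontier U, IsOuterUnitNormal U x (ν x))
    {F : EuclideanSpace ℝ (Fin n) → ℝ} (hF : ContinuousOn F (frontier U)) :
    IntegrableOn F (frontier U) μHE[n - 1] := by
  obtain ⟨C, hC⟩ := hU.isCompact_frontier.exists_bound_of_continuousOn hF
  exact IntegrableOn.of_bound (hU.euclideanHausdorffMeasure_frontier_lt_top hν)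
    (hF.aestronglyMeasurable isClosed_frontier.measurableSet) C
    ((ae_restrict_iff' isClosed_frontier.measurableSet).2 (Eventually.of_forall hC))

/-- At an interior point a ball inside `U` serves: the boundary integral is empty, and the
derivative of a compactly supported function integrates to zero. -/
theorem exists_integral_fderiv_eq_of_mem_closure (hU : IsBoundedC1Domain U)
    (hν : ∀ x ∈ frontier U, IsOuterUnitNormal U x (ν x))
    {x₀ : EuclideanSpace ℝ (Fin n)} (hx₀ : x₀ ∈ closure U) :
    ∃ r > 0, ∀ f : EuclideanSpace ℝ (Fin n) → ℝ, ContDiff ℝ 1 f → HasCompactSupport f →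
        tsupport f ⊆ Metric.ball x₀ r → ∀ w, ∫ x in U, fderiv ℝ f x w
          = ∫ x in frontier U, f x * ⟪ν x, w⟫_ℝ ∂μHE[n - 1] := by
  by_cases hx : x₀ ∈ frontier U
  · obtain ⟨r, hr, -, -, h⟩ := hU.exists_integral_fderiv_eq hν hx
    exact ⟨r, hr, h⟩
  have hxU : x₀ ∈ U := by
    by_contra hn
    exact hx (hU.isOpen.frontier_eq ▸ ⟨hx₀, hn⟩)
  obtain ⟨r, hr, hball⟩ := Metric.isOpen_iff.1 hU.isOpen x₀ hxU
  refine ⟨r, hr, fun f hf hfc hfs w => ?_⟩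
  have h0 : ∫ x in frontier U, f x * ⟪ν x, w⟫_ℝ ∂μHE[n - 1] = 0 := by
    refine setIntegral_eq_zero_of_forall_eq_zero fun x hx => ?_
    rw [image_eq_zero_of_notMem_tsupport (f := f), zero_mul]
    intro hxs
    rw [hU.isOpen.frontier_eq] at hx
    exact hx.2 (hball (hfs hxs))
  rw [h0, setIntegral_eq_integral_of_forall_compl_eq_zero]
  · have h1 : Continuous fun x => fderiv ℝ f x w := by
      have := hf.continuous_fderiv one_ne_zero
      fun_prop
    have h2 := integral_mul_fderiv_eq_neg_fderiv_mul_of_integrable (μ := volume)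
      (f := fun _ : EuclideanSpace ℝ (Fin n) => (1 : ℝ)) (g := f) (v := w)
      (by simp) (by
        simp only [one_mul]
        exact h1.integrable_of_hasCompactSupport
          ((hfc.fderiv (𝕜 := ℝ)).comp_left
            (g := fun A : EuclideanSpace ℝ (Fin n) →L[ℝ] ℝ => A w) (by simp)))
      (by
        simp only [one_mul]
        exact hf.continuous.integrable_of_hasCompactSupport hfc)
      (fun x _ => differentiableAt_const _) (fun x _ => hf.differentiable one_ne_zero x)
    simpa using h2
  · intro x hx
    rw [image_eq_zero_of_notMem_tsupport (f := fderiv ℝ f)]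
    · simp
    · exact fun hxs => hx (hball (hfs (tsupport_fderiv_subset ℝ hxs)))

/-- The divergence theorem on a bounded domain with `C¹` boundary, for the partial derivative
of a function in the direction `w`. -/
theorem integral_fderiv_eq (hU : IsBoundedC1Domain U)
    (hν : ∀ x ∈ frontier U, IsOuterUnitNormal U x (ν x))
    {f : EuclideanSpace ℝ (Fin n) → ℝ} (hf : ContDiff ℝ 1 f) (hfc : HasCompactSupport f)
    (w : EuclideanSpace ℝ (Fin n)) :
    ∫ x in U, fderiv ℝ f x w = ∫ x in frontier U, f x * ⟪ν x, w⟫_ℝ ∂μHE[n - 1] := by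
  have hloc : ∀ x₀ : closure U, ∃ r > 0, ∀ f : EuclideanSpace ℝ (Fin n) → ℝ,
      ContDiff ℝ 1 f → HasCompactSupport f →
        tsupport f ⊆ Metric.ball x₀ r → ∀ w, ∫ x in U, fderiv ℝ f x w
          = ∫ x in frontier U, f x * ⟪ν x, w⟫_ℝ ∂μHE[n - 1] := fun x₀ =>
    hU.exists_integral_fderiv_eq_of_mem_closure hν x₀.2
  choose r hr hrf using hloc
  obtain ⟨t, ht⟩ := hU.isCompact_closure.elim_finite_subcover
    (fun x₀ : closure U => Metric.ball (x₀ : EuclideanSpace ℝ (Fin n)) (r x₀ / 3))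
    (fun x₀ => Metric.isOpen_ball) (fun x hx => mem_iUnion.2
      ⟨⟨x, hx⟩, Metric.mem_ball_self (by have := hr ⟨x, hx⟩; positivity)⟩)
  have hint : ∀ f : EuclideanSpace ℝ (Fin n) → ℝ, ContDiff ℝ 1 f → HasCompactSupport f →
      IntegrableOn (fun x => fderiv ℝ f x w) U := fun f hf hfc => by
    have h1 : Continuous fun x => fderiv ℝ f x w := by
      have := hf.continuous_fderiv one_ne_zero
      fun_prop
    exact (h1.integrable_of_hasCompactSupport ((hfc.fderiv (𝕜 := ℝ)).comp_left
      (g := fun A : EuclideanSpace ℝ (Fin n) →L[ℝ] ℝ => A w) (by simp))).integrableOn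
  have hintb : ∀ f : EuclideanSpace ℝ (Fin n) → ℝ, ContDiff ℝ 1 f →
      IntegrableOn (fun x => f x * ⟪ν x, w⟫_ℝ) (frontier U) μHE[n - 1] := fun f hf =>
    hU.integrableOn_frontier hν (hf.continuous.continuousOn.mul
      ((hU.continuousOn_normal hν).inner continuousOn_const))
  -- Induction on the number of balls needed to cover the part of the closure near which `f` does
  -- not vanish. A bump ψ equal to 1 on one ball splits f = ψf + (1 − ψ)f: the first term is local,
  -- the second no longer needs that ball.
  have key : ∀ (t : Finset (closure U)) (f : EuclideanSpace ℝ (Fin n) → ℝ), ContDiff ℝ 1 f →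
      HasCompactSupport f → (∀ x ∈ closure U,
        (∀ x₀ ∈ t, x ∉ Metric.ball (x₀ : EuclideanSpace ℝ (Fin n)) (r x₀ / 3)) → f =ᶠ[𝓝 x] 0) →
      ∫ x in U, fderiv ℝ f x w = ∫ x in frontier U, f x * ⟪ν x, w⟫_ℝ ∂μHE[n - 1] := by
    intro t
    induction t using Finset.cons_induction with
    | empty =>
      intro f hf hfc h0
      rw [setIntegral_eq_zero_of_forall_eq_zero, setIntegral_eq_zero_of_forall_eq_zero]
      · intro x hx
        rw [(h0 x (frontier_subset_closure hx) (by simp)).self_of_nhds]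
        simp
      · intro x hx
        rw [(h0 x (subset_closure hx) (by simp)).fderiv_eq]
        simp
    | cons x₁ t hx₁ ih =>
      intro f hf hfc h0
      have hr1 := hr x₁
      let ψ : ContDiffBump (x₁ : EuclideanSpace ℝ (Fin n)) :=
        ⟨r x₁ / 3, r x₁ / 2, by positivity, by linarith⟩
      have hψ : ContDiff ℝ 1 ψ := ψ.contDiff
      have hf1 : ContDiff ℝ 1 fun x => ψ x * f x := hψ.mul hf
      have hf2 : ContDiff ℝ 1 fun x => (1 - ψ x) * f x := (contDiff_const.sub hψ).mul hf
      have hc1 : HasCompactSupport fun x => ψ x * f x := hfc.mul_left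
      have hc2 : HasCompactSupport fun x => (1 - ψ x) * f x := hfc.mul_left
      have e1 := hrf x₁ _ hf1 hc1 (by
        refine (closure_mono (Function.support_mul_subset_left _ _)).trans ?_
        have := ψ.tsupport_eq
        unfold tsupport at this
        rw [this]
        exact Metric.closedBall_subset_ball (by show r x₁ / 2 < r x₁; linarith)) w
      have e2 := ih _ hf2 hc2 (by
        intro x hx hxt
        by_cases hxb : x ∈ Metric.ball (x₁ : EuclideanSpace ℝ (Fin n)) (r x₁ / 3)
        · filter_upwards [ψ.eventuallyEq_one_of_mem_ball hxb] with y hy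
          simp [hy]
        · filter_upwards [h0 x hx (by
            intro x₀ hx₀
            rcases Finset.mem_cons.1 hx₀ with rfl | hx₀
            · exact hxb
            · exact hxt x₀ hx₀)] with y hy
          simp [hy])
      have hd : ∀ x, fderiv ℝ f x w = fderiv ℝ (fun x => ψ x * f x) x w
          + fderiv ℝ (fun x => (1 - ψ x) * f x) x w := fun x => by
        rw [← add_apply, ← fderiv_fun_add (hf1.differentiable one_ne_zero x)
          (hf2.differentiable one_ne_zero x)]
        congr 2
        ext y
        ring
      simp only [hd]
      rw [integral_add (hint _ hf1 hc1) (hint _ hf2 hc2), e1, e2,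
        ← integral_add (hintb _ hf1) (hintb _ hf2)]
      refine integral_congr_ae (Eventually.of_forall fun x => ?_)
      simp only
      ring
  refine key t f hf hfc fun x hx hxt => ?_
  obtain ⟨x₀, hx₀, hxx⟩ := mem_iUnion₂.1 (ht hx)
  exact absurd hxx (hxt x₀ hx₀)

end IsBoundedC1Domain

end DivergenceTheorem

/-! ### Derivative of the determinant at the identity. -/

section Determinant

variable {E : Type*} [NormedAddCommGroup E] [NormedSpace ℝ E] [FiniteDimensional ℝ E]

theorem differentiable_continuousLinearMap_det :
    Differentiable ℝ (fun A : E →L[ℝ] E => A.det) := by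
  let b := Module.finBasis ℝ E
  have h : (fun A : E →L[ℝ] E => A.det)
      = fun A => ∑ σ : Equiv.Perm (Fin (Module.finrank ℝ E)), ((Equiv.Perm.sign σ : ℤ) : ℝ)
          * ∏ i, b.equivFun (A (b i)) (σ i) := by
    ext A
    rw [ContinuousLinearMap.det, ← LinearMap.det_toMatrix b, Matrix.det_apply]
    simp [LinearMap.toMatrix_apply, Units.smul_def, zsmul_eq_mul]
  rw [h]
  have hd : ∀ i j, Differentiable ℝ fun A : E →L[ℝ] E => b.equivFun (A (b i)) j := fun i j => by
    let ℓ : E →L[ℝ] ℝ := LinearMap.toContinuousLinearMap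
      ((LinearMap.proj j).comp b.equivFun.toLinearMap)
    exact ℓ.differentiable.comp (ContinuousLinearMap.apply ℝ E (b i)).differentiable
  refine Differentiable.fun_sum fun σ _ => Differentiable.const_mul ?_ _
  exact fun A => (HasFDerivAt.finsetProd (u := Finset.univ)
    (g := fun i (A : E →L[ℝ] E) => b.equivFun (A (b i)) (σ i))
    fun i _ => (hd i (σ i) A).hasFDerivAt).differentiableAt

/-- Only directional derivatives have to be computed, and det(1 + rA) is a polynomial in r with
linear coefficient tr A. Applied to the flow Jacobian, this produces div v in the transport theorem.
-/
theorem hasFDerivAt_continuousLinearMap_det_one : ∃ D : (E →L[ℝ] E) →L[ℝ] ℝ,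
    HasFDerivAt (fun A : E →L[ℝ] E => A.det) D 1 ∧ ∀ A, D A = LinearMap.trace ℝ E A := by
  have hD := (differentiable_continuousLinearMap_det (E := E) 1).hasFDerivAt
  refine ⟨_, hD, fun A => ?_⟩
  have h1 := hD.hasLineDerivAt A
  refine HasDerivAt.unique h1 ?_
  let b := Module.finBasis ℝ E
  set M := LinearMap.toMatrix b b (A : E →ₗ[ℝ] E) with hM
  have h2 : ∀ r : ℝ, (1 + r • A).det = 1 + LinearMap.trace ℝ E A * r
      + (Matrix.det (1 + (Polynomial.X : Polynomial ℝ) • M.map Polynomial.C)).divX.divX.eval r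
        * r ^ 2 := fun r => by
    rw [ContinuousLinearMap.det, ← LinearMap.det_toMatrix b, LinearMap.trace_eq_matrix_trace ℝ b,
      ← hM, ← Matrix.det_one_add_smul]
    congr 1
    simp [hM]
  simp only [h2]
  have h3 := ((hasDerivAt_const (0 : ℝ) (1 : ℝ)).add
    ((hasDerivAt_id (0 : ℝ)).const_mul (LinearMap.trace ℝ E A))).add
    ((Polynomial.hasDerivAt (Matrix.det (1 + (Polynomial.X : Polynomial ℝ)
      • M.map Polynomial.C)).divX.divX 0).mul ((hasDerivAt_id (0 : ℝ)).pow 2))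
  convert! h3 using 1
  simp

end Determinant

/-! ### Quantitative estimates for trajectories. -/

section Trajectories

variable {E : Type*} [NormedAddCommGroup E] [NormedSpace ℝ E] {J : Set ℝ} {v : ℝ → E → E}
  {t s R M L : ℝ}

theorem uIcc_subset_of_ordConnected (hJ : J.OrdConnected) (ht : t ∈ J) (hs : s ∈ J) :
    uIcc t s ⊆ J := hJ.uIcc_subset ht hs

theorem abs_sub_le_of_mem_uIcc' {τ : ℝ} (hτ : τ ∈ uIcc t s) : |τ - t| ≤ |s - t| := by
  rcases le_total t s with h | h
  · rw [uIcc_of_le h] at hτ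
    rw [abs_of_nonneg (by linarith [hτ.1]), abs_of_nonneg (by linarith)]
    linarith [hτ.2]
  · rw [uIcc_of_ge h] at hτ
    rw [abs_of_nonpos (by linarith [hτ.2]), abs_of_nonpos (by linarith)]
    linarith [hτ.1]

/-- A trajectory starting in the ball of radius `R` moves at most with the speed bound on the
ball of radius `R + 1` as long as it cannot leave this larger ball. -/
theorem norm_trajectory_sub_le (hJ : J.OrdConnected) (ht : t ∈ J) (hs : s ∈ J) {z : ℝ → E}
    (hz : ∀ τ ∈ J, HasDerivWithinAt z (v τ (z τ)) J τ) (hzR : ‖z t‖ ≤ R)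
    (hM : ∀ τ ∈ J, ∀ x, ‖x‖ ≤ R + 1 → ‖v τ x‖ < M) (hst : M * |s - t| ≤ 1) :
    ‖z s - z t‖ ≤ M * |s - t| := by
  rcases eq_or_ne s t with rfl | hne
  · simp
  have hpos : 0 < |s - t| := abs_pos.2 (sub_ne_zero.2 hne)
  -- The affine parameter θ runs forward from `t` to `s` whichever of the two is larger.
  let c : ℝ → ℝ := fun θ => t + θ * (s - t)
  have hcJ : MapsTo c (Icc 0 1) J := fun θ hθ => by
    refine hJ.uIcc_subset ht hs ?_
    rw [← segment_eq_uIcc]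
    exact ⟨1 - θ, θ, by linarith [hθ.2], hθ.1, by ring, by simp only [c, smul_eq_mul]; ring⟩
  have hw : ∀ θ ∈ Icc (0 : ℝ) 1, HasDerivWithinAt (fun θ => z (c θ) - z t)
      ((s - t) • v (c θ) (z (c θ))) (Icc 0 1) θ := fun θ hθ => by
    have h1 : HasDerivWithinAt c (s - t) (Icc 0 1) θ := by
      have := ((hasDerivAt_id θ).mul_const (s - t)).const_add t
      rw [one_mul] at this
      exact this.hasDerivWithinAt
    exact ((hz _ (hcJ hθ)).scomp θ h1 hcJ).sub_const _
  -- Barrier argument: when the displacement touches M|s − t|θ ≤ 1, the trajectory is still in the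
  -- ball of radius R + 1, where its speed is strictly below `M`.
  have key := image_norm_le_of_norm_deriv_right_lt_deriv_boundary
    (f := fun θ => z (c θ) - z t) (a := 0) (b := 1) (B := fun θ => M * |s - t| * θ)
    (B' := fun _ => M * |s - t|) (f' := fun θ => (s - t) • v (c θ) (z (c θ)))
    (fun θ hθ => (hw θ hθ).continuousWithinAt)
    (fun θ hθ => (hw θ ⟨hθ.1, hθ.2.le⟩).mono_of_mem_nhdsWithin
      (Icc_mem_nhdsGE_of_mem hθ))
    (by simp [c]) (fun θ => by simpa using (hasDerivAt_id θ).const_mul (M * |s - t|))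
    (fun θ hθ heq => ?_) (show (1 : ℝ) ∈ Icc (0 : ℝ) 1 by simp)
  · simpa [c] using key
  · rw [norm_smul, Real.norm_eq_abs, mul_comm]
    refine mul_lt_mul_of_pos_right (hM _ (hcJ ⟨hθ.1, hθ.2.le⟩) _ ?_) hpos
    have h1 : ‖z (c θ) - z t‖ ≤ 1 := by
      have h0 : ‖z (c θ) - z t‖ = M * |s - t| * θ := heq
      have h2 : 0 ≤ M * |s - t| * θ := h0 ▸ norm_nonneg _
      have := hθ.1
      have := hθ.2
      rw [h0]
      nlinarith
    calc ‖z (c θ)‖ = ‖z t + (z (c θ) - z t)‖ := by congr 1; abel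
      _ ≤ R + 1 := (norm_add_le _ _).trans (add_le_add hzR h1)

theorem norm_trajectory_le (hJ : J.OrdConnected) (ht : t ∈ J) (hs : s ∈ J) {z : ℝ → E}
    (hz : ∀ τ ∈ J, HasDerivWithinAt z (v τ (z τ)) J τ) (hzR : ‖z t‖ ≤ R)
    (hM : ∀ τ ∈ J, ∀ x, ‖x‖ ≤ R + 1 → ‖v τ x‖ < M) (hst : M * |s - t| ≤ 1) :
    ‖z s‖ ≤ R + 1 := by
  calc ‖z s‖ = ‖z t + (z s - z t)‖ := by congr 1; abel
    _ ≤ R + 1 := (norm_add_le _ _).trans (add_le_add hzR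
      ((norm_trajectory_sub_le hJ ht hs hz hzR hM hst).trans hst))

/-- Let m be the largest separation between times t and s. The mean value inequality gives m ≤ ‖z₁ t
− z₂ t‖ + L m |s − t|, and 2L|s − t| ≤ 1 absorbs the last term, whence the factor 2. Equal data at
time t give uniqueness. -/
theorem norm_trajectory_sub_trajectory_le (hJ : J.OrdConnected) (ht : t ∈ J) (hs : s ∈ J)
    {z₁ z₂ : ℝ → E}
    (hz₁ : ∀ τ ∈ J, HasDerivWithinAt z₁ (v τ (z₁ τ)) J τ) (hz₁R : ‖z₁ t‖ ≤ R)
    (hz₂ : ∀ τ ∈ J, HasDerivWithinAt z₂ (v τ (z₂ τ)) J τ) (hz₂R : ‖z₂ t‖ ≤ R)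
    (hM : ∀ τ ∈ J, ∀ x, ‖x‖ ≤ R + 1 → ‖v τ x‖ < M) (hst : M * |s - t| ≤ 1)
    (hL0 : 0 ≤ L)
    (hL : ∀ τ ∈ J, ∀ x y, ‖x‖ ≤ R + 1 → ‖y‖ ≤ R + 1 → ‖v τ x - v τ y‖ ≤ L * ‖x - y‖)
    (hLst : 2 * L * |s - t| ≤ 1) :
    ‖z₁ s - z₂ s‖ ≤ 2 * ‖z₁ t - z₂ t‖ ∧
      ‖z₁ s - z₂ s - (z₁ t - z₂ t)‖ ≤ 2 * L * |s - t| * ‖z₁ t - z₂ t‖ := by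
  have hM0 : 0 ≤ M := (norm_nonneg _).trans (hM t ht (z₁ t) (by linarith)).le
  have hsub := uIcc_subset_of_ordConnected hJ ht hs
  have hD : ∀ τ ∈ uIcc t s, HasDerivWithinAt (fun τ => z₁ τ - z₂ τ)
      (v τ (z₁ τ) - v τ (z₂ τ)) (uIcc t s) τ := fun τ hτ =>
    ((hz₁ τ (hsub hτ)).mono hsub).sub ((hz₂ τ (hsub hτ)).mono hsub)
  obtain ⟨σ, hσ, hmax⟩ := isCompact_uIcc.exists_isMaxOn (⟨t, left_mem_uIcc⟩ : (uIcc t s).Nonempty)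
    (f := fun τ => ‖z₁ τ - z₂ τ‖) (fun τ hτ => (hD τ hτ).continuousWithinAt.norm)
  set m := ‖z₁ σ - z₂ σ‖ with hm
  have hm0 : 0 ≤ m := norm_nonneg _
  have hmv : ∀ τ ∈ uIcc t s, ‖z₁ τ - z₂ τ - (z₁ t - z₂ t)‖ ≤ L * m * |τ - t| := fun τ hτ => by
    refine (convex_uIcc t s).norm_image_sub_le_of_norm_hasDerivWithin_le
      (f := fun τ => z₁ τ - z₂ τ) hD (fun τ' hτ' => ?_) left_mem_uIcc hτ
    have hst' : M * |τ' - t| ≤ 1 :=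
      (mul_le_mul_of_nonneg_left (abs_sub_le_of_mem_uIcc' hτ') hM0).trans hst
    refine (hL τ' (hsub hτ') _ _ (norm_trajectory_le hJ ht (hsub hτ') hz₁ hz₁R hM hst')
      (norm_trajectory_le hJ ht (hsub hτ') hz₂ hz₂R hM hst')).trans ?_
    exact mul_le_mul_of_nonneg_left (hmax hτ') hL0
  have hmm : m ≤ 2 * ‖z₁ t - z₂ t‖ := by
    have h1 := hmv σ hσ
    have h2 : L * m * |σ - t| ≤ m / 2 := by
      have := mul_le_mul_of_nonneg_left (abs_sub_le_of_mem_uIcc' hσ) (mul_nonneg hL0 hm0)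
      nlinarith
    have h3 : m ≤ ‖z₁ t - z₂ t‖ + ‖z₁ σ - z₂ σ - (z₁ t - z₂ t)‖ := by
      rw [hm]
      calc ‖z₁ σ - z₂ σ‖ = ‖(z₁ t - z₂ t) + (z₁ σ - z₂ σ - (z₁ t - z₂ t))‖ := by congr 1; abel
        _ ≤ _ := norm_add_le _ _
    linarith
  refine ⟨(hmax right_mem_uIcc).trans hmm, (hmv s right_mem_uIcc).trans ?_⟩
  have := mul_le_mul_of_nonneg_left hmm (mul_nonneg hL0 (abs_nonneg (s - t)))
  nlinarith

/-- Separations obey the linearized equation up to an error proportional to the initial separation,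
so the estimate passes to the spatial derivative of the flow map wherever that derivative exists. -/
theorem exists_norm_trajectory_sub_trajectory_sub_le (hJ : J.OrdConnected) (ht : t ∈ J)
    (hM : ∀ τ ∈ J, ∀ x, ‖x‖ ≤ R + 1 → ‖v τ x‖ < M) (hL0 : 0 ≤ L)
    (hL : ∀ τ ∈ J, ∀ x y, ‖x‖ ≤ R + 1 → ‖y‖ ≤ R + 1 → ‖v τ x - v τ y‖ ≤ L * ‖x - y‖)
    {x : E} {A : E →L[ℝ] E}
    (hA : ∀ ε > 0, ∃ δ > 0, ∀ τ ∈ J, |τ - t| < δ → ∀ y ∈ Metric.ball x δ, ∀ y' ∈ Metric.ball x δ,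
      ‖v τ y - v τ y' - A (y - y')‖ ≤ ε * ‖y - y'‖) {ε : ℝ} (hε : 0 < ε) :
    ∃ δ > 0, ∀ s ∈ J, |s - t| < δ → ∀ z₁ z₂ : ℝ → E,
      (∀ τ ∈ J, HasDerivWithinAt z₁ (v τ (z₁ τ)) J τ) → ‖z₁ t‖ ≤ R → z₁ t ∈ Metric.ball x δ →
      (∀ τ ∈ J, HasDerivWithinAt z₂ (v τ (z₂ τ)) J τ) → ‖z₂ t‖ ≤ R → z₂ t ∈ Metric.ball x δ →
      ‖z₁ s - z₂ s - (z₁ t - z₂ t) - (s - t) • A (z₁ t - z₂ t)‖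
        ≤ ε * |s - t| * ‖z₁ t - z₂ t‖ := by
  obtain ⟨δ₁, hδ₁, hδA⟩ := hA (ε / 4) (by positivity)
  -- `B` keeps both trajectories in the ball where `A` approximates `v` and makes the previous
  -- estimates applicable. The error splits into (ε/4)·2‖a‖ from this approximation and ‖A‖·2L|τ −
  -- t|‖a‖ ≤ (ε/2)‖a‖, by the choice of `C`, from the drift of the separation.
  set B := |M| + 2 * L + 1 with hB
  have hBpos : 0 < B := by positivity
  set C := 4 * ‖A‖ * L + 1 with hC
  have hCpos : 0 < C := by positivity
  refine ⟨min (min (δ₁ / 2) (δ₁ / (2 * B))) (min (1 / B) (ε / C)), by positivity, ?_⟩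
  intro s hs hsδ z₁ z₂ hz₁ hz₁R hz₁x hz₂ hz₂R hz₂x
  have hs1 : |s - t| < δ₁ / 2 := hsδ.trans_le ((min_le_left _ _).trans (min_le_left _ _))
  have hs2 : B * |s - t| < δ₁ / 2 := by
    have : |s - t| < δ₁ / (2 * B) := hsδ.trans_le ((min_le_left _ _).trans (min_le_right _ _))
    rw [lt_div_iff₀ (by positivity)] at this
    linarith
  have hs3 : B * |s - t| < 1 := by
    have : |s - t| < 1 / B := hsδ.trans_le ((min_le_right _ _).trans (min_le_left _ _))
    rw [lt_div_iff₀ hBpos] at this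
    linarith
  have hs4 : C * |s - t| < ε := by
    have : |s - t| < ε / C := hsδ.trans_le ((min_le_right _ _).trans (min_le_right _ _))
    rw [lt_div_iff₀ hCpos] at this
    linarith
  have hz₁x' : z₁ t ∈ Metric.ball x (δ₁ / 2) :=
    Metric.ball_subset_ball ((min_le_left _ _).trans (min_le_left _ _)) hz₁x
  have hz₂x' : z₂ t ∈ Metric.ball x (δ₁ / 2) :=
    Metric.ball_subset_ball ((min_le_left _ _).trans (min_le_left _ _)) hz₂x
  have hsub := uIcc_subset_of_ordConnected hJ ht hs
  set a := z₁ t - z₂ t with ha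
  have hmv := (convex_uIcc t s).norm_image_sub_le_of_norm_hasDerivWithin_le
    (f := fun τ => z₁ τ - z₂ τ - (τ - t) • A a)
    (f' := fun τ => v τ (z₁ τ) - v τ (z₂ τ) - A a) (C := ε * ‖a‖)
    (fun τ hτ => by
      have h1 : HasDerivWithinAt (fun τ : ℝ => (τ - t) • A a) ((1 : ℝ) • A a) (uIcc t s) τ :=
        (((hasDerivAt_id τ).sub_const t).smul_const (A a)).hasDerivWithinAt
      rw [one_smul] at h1
      exact (((hz₁ τ (hsub hτ)).mono hsub).sub ((hz₂ τ (hsub hτ)).mono hsub)).sub h1)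
    (fun τ hτ => by
      have hτs := abs_sub_le_of_mem_uIcc' hτ
      have hτB : B * |τ - t| ≤ B * |s - t| := mul_le_mul_of_nonneg_left hτs hBpos.le
      have hτ0 := abs_nonneg (τ - t)
      have hMτ : M * |τ - t| ≤ B * |τ - t| :=
        mul_le_mul_of_nonneg_right (by rw [hB]; linarith [le_abs_self M]) hτ0
      have hLτ : 2 * L * |τ - t| ≤ B * |τ - t| :=
        mul_le_mul_of_nonneg_right (by rw [hB]; linarith [abs_nonneg M]) hτ0
      have hin : ∀ z : ℝ → E, (∀ τ ∈ J, HasDerivWithinAt z (v τ (z τ)) J τ) → ‖z t‖ ≤ R →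
          z t ∈ Metric.ball x (δ₁ / 2) → z τ ∈ Metric.ball x δ₁ := fun z hz hzR hzx => by
        have h1 := norm_trajectory_sub_le hJ ht (hsub hτ) hz hzR hM (by linarith)
        rw [mem_ball_iff_norm] at hzx ⊢
        calc ‖z τ - x‖ = ‖(z τ - z t) + (z t - x)‖ := by congr 1; abel
          _ ≤ ‖z τ - z t‖ + ‖z t - x‖ := norm_add_le _ _
          _ < δ₁ := by linarith
      obtain ⟨h2, h3⟩ := norm_trajectory_sub_trajectory_le hJ ht (hsub hτ) hz₁ hz₁R hz₂ hz₂R hM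
        (by linarith) hL0 hL (by linarith)
      rw [← ha] at h2 h3
      have h4 := hδA τ (hsub hτ) (by linarith) _ (hin z₁ hz₁ hz₁R hz₁x') _
        (hin z₂ hz₂ hz₂R hz₂x')
      have h5 : ‖A (z₁ τ - z₂ τ - a)‖ ≤ ‖A‖ * (2 * L * |τ - t| * ‖a‖) :=
        (A.le_opNorm _).trans (mul_le_mul_of_nonneg_left h3 (norm_nonneg _))
      have h6 : ε / 4 * ‖z₁ τ - z₂ τ‖ ≤ ε / 4 * (2 * ‖a‖) :=
        mul_le_mul_of_nonneg_left h2 (by positivity)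
      have h7 : C * |τ - t| ≤ ε := (mul_le_mul_of_nonneg_left hτs hCpos.le).trans hs4.le
      have h8 : 4 * ‖A‖ * L * |τ - t| ≤ ε := by
        rw [hC] at h7
        nlinarith
      have h9 := mul_le_mul_of_nonneg_right h8 (norm_nonneg a)
      calc ‖v τ (z₁ τ) - v τ (z₂ τ) - A a‖
          = ‖(v τ (z₁ τ) - v τ (z₂ τ) - A (z₁ τ - z₂ τ)) + A (z₁ τ - z₂ τ - a)‖ := by
            rw [map_sub A _ a]; congr 1; abel
        _ ≤ _ := norm_add_le _ _
        _ ≤ ε * ‖a‖ := by nlinarith [norm_nonneg a])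
    left_mem_uIcc right_mem_uIcc
  have heq : z₁ s - z₂ s - (s - t) • A a - (z₁ t - z₂ t - (t - t) • A a)
      = z₁ s - z₂ s - a - (s - t) • A a := by
    rw [sub_self, zero_smul, sub_zero, ← ha]; abel
  simp only [heq] at hmv
  rw [Real.norm_eq_abs] at hmv
  linarith

end Trajectories

/-! ### Change of variables and Reynolds' transport theorem. -/

section Transport

open scoped NNReal ENNReal

variable {E : Type*} [NormedAddCommGroup E] [InnerProductSpace ℝ E] [FiniteDimensional ℝ E]
  [MeasurableSpace E] [BorelSpace E]

/-- Change of variables for an injective Lipschitz map of an open set; the matrix field `D` is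
only required to be the derivative where the latter exists. -/
theorem integral_image_eq_integral_abs_det_of_lipschitzOnWith {S : Set E} (hS : IsOpen S)
    {ψ : E → E} {K : ℝ≥0} (hψ : LipschitzOnWith K ψ S) (hinj : InjOn ψ S) {D : E → E →L[ℝ] E}
    (hD : ∀ x ∈ S, DifferentiableAt ℝ ψ x → D x = fderiv ℝ ψ x) (g : E → ℝ) :
    ∫ y in ψ '' S, g y = ∫ x in S, |(D x).det| * g (ψ x) := by
  -- By Rademacher's theorem `S'` has full measure in `S`.
  set S' := S ∩ {x | DifferentiableAt ℝ ψ x} with hS'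
  have hS'm : MeasurableSet S' := hS.measurableSet.inter (measurableSet_of_differentiableAt ℝ ψ)
  have hnull : volume (S \ S') = 0 := by
    have h1 := hψ.ae_differentiableWithinAt_of_mem (μ := volume)
    refine measure_mono_null (fun x hx => ?_) h1
    intro h2
    exact hx.2 ⟨hx.1, (h2 hx.1).differentiableAt (hS.mem_nhds hx.1)⟩
  -- A Lipschitz map sends null sets to null sets, seen here through Hausdorff measure.
  have hnull' : volume (ψ '' (S \ S')) = 0 := by
    rw [← InnerProductSpace.euclideanHausdorffMeasure_eq_volume] at hnull ⊢
    have h2 := hausdorffMeasure_image_le_of_edist_le (F := ψ) (G := fun x => x) (s := S \ S')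
      (K := K) (fun x hx y hy => hψ hx.1 hy.1) (Module.finrank ℝ E)
    rw [image_id', hnull, mul_zero] at h2
    exact le_antisymm h2 zero_le
  have hae : S' =ᵐ[volume] S := by
    refine (ae_eq_set.2 ⟨?_, hnull⟩)
    rw [sdiff_eq_empty.2 inter_subset_left, measure_empty]
  have hae' : ψ '' S' =ᵐ[volume] ψ '' S := by
    refine ae_eq_set.2 ⟨?_, measure_mono_null ?_ hnull'⟩
    · rw [sdiff_eq_empty.2 (image_mono inter_subset_left), measure_empty]
    · rintro _ ⟨⟨x, hx, rfl⟩, hx'⟩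
      exact ⟨x, ⟨hx, fun h => hx' ⟨x, h, rfl⟩⟩, rfl⟩
  rw [← setIntegral_congr_set hae', ← setIntegral_congr_set hae,
    integral_image_eq_integral_abs_det_fderiv_smul volume hS'm
      (fun x hx => (hD x hx.1 hx.2 ▸ hx.2.hasFDerivAt).hasFDerivWithinAt)
      (hinj.mono inter_subset_left)]
  rfl

omit [FiniteDimensional ℝ E] [MeasurableSpace E] [BorelSpace E] in
theorem contDiff_slice_of_contDiffOn {F : Type*} [NormedAddCommGroup F] [NormedSpace ℝ F]
    {J : Set ℝ} {v : ℝ → E → F}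
    (hv : ContDiffOn ℝ 1 (fun z : ℝ × E => v z.1 z.2) (J ×ˢ univ)) {t : ℝ} (ht : t ∈ J) :
    ContDiff ℝ 1 (v t) := by
  rw [← contDiffOn_univ]
  exact hv.comp (contDiff_prodMk_right t).contDiffOn fun x _ => ⟨ht, mem_univ _⟩

omit [FiniteDimensional ℝ E] [MeasurableSpace E] [BorelSpace E] in
theorem hasFDerivAt_slice_of_hasFDerivWithinAt {F : Type*} [NormedAddCommGroup F]
    [NormedSpace ℝ F] {J : Set ℝ} {v : ℝ → E → F} {t : ℝ} (ht : t ∈ J) {x : E}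
    {v' : ℝ × E →L[ℝ] F}
    (h : HasFDerivWithinAt (fun z : ℝ × E => v z.1 z.2) v' (J ×ˢ univ) (t, x)) :
    HasFDerivAt (v t) (v'.comp (ContinuousLinearMap.inr ℝ ℝ E)) x := by
  rw [← hasFDerivWithinAt_univ]
  exact HasFDerivWithinAt.comp (g := fun z : ℝ × E => v z.1 z.2) (f := fun x => (t, x)) x h
    (hasFDerivAt_prodMk_right t x).hasFDerivWithinAt fun x _ => ⟨ht, mem_univ _⟩

-- Joint continuity of the spatial derivative and the mean value inequality on a ball make the
-- differentiability of `v τ` at `x` strict, uniformly for τ near t.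
omit [FiniteDimensional ℝ E] [MeasurableSpace E] [BorelSpace E] in
theorem exists_norm_sub_sub_fderiv_le {a b t : ℝ} (hab : a < b) (ht : t ∈ Icc a b)
    {v : ℝ → E → E} (hv : ContDiffOn ℝ 1 (fun z : ℝ × E => v z.1 z.2) (Icc a b ×ˢ univ))
    (x : E) {ε : ℝ} (hε : 0 < ε) :
    ∃ δ > 0, ∀ τ ∈ Icc a b, |τ - t| < δ → ∀ y ∈ Metric.ball x δ, ∀ y' ∈ Metric.ball x δ,
      ‖v τ y - v τ y' - fderiv ℝ (v t) x (y - y')‖ ≤ ε * ‖y - y'‖ := by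
  have hud : UniqueDiffOn ℝ (Icc a b ×ˢ (univ : Set E)) :=
    (uniqueDiffOn_Icc hab).prod uniqueDiffOn_univ
  have hG := hv.continuousOn_fderivWithin hud le_rfl
  set G := fderivWithin ℝ (fun z : ℝ × E => v z.1 z.2) (Icc a b ×ˢ univ) with hGdef
  have hsl : ∀ τ ∈ Icc a b, ∀ y, HasFDerivAt (v τ)
      ((G (τ, y)).comp (ContinuousLinearMap.inr ℝ ℝ E)) y := fun τ hτ y =>
    hasFDerivAt_slice_of_hasFDerivWithinAt hτ
      (hv.differentiableOn one_ne_zero (τ, y) ⟨hτ, mem_univ _⟩).hasFDerivWithinAt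
  have hc : ContinuousWithinAt (fun z => (G z).comp (ContinuousLinearMap.inr ℝ ℝ E))
      (Icc a b ×ˢ univ) (t, x) :=
    (hG (t, x) ⟨ht, mem_univ _⟩).clm_comp continuousWithinAt_const
  obtain ⟨δ, hδ, h⟩ := Metric.continuousWithinAt_iff.1 hc ε hε
  refine ⟨δ, hδ, fun τ hτ hτδ y hy y' hy' => ?_⟩
  rw [(hsl t ht x).fderiv]
  refine Convex.norm_image_sub_le_of_norm_hasFDerivWithin_le' (s := Metric.ball x δ)
    (fun w _ => (hsl τ hτ w).hasFDerivWithinAt) (fun w hw => ?_) (convex_ball x δ) hy' hy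
  rw [← dist_eq_norm]
  refine (h ⟨hτ, mem_univ _⟩ ?_).le
  rw [Prod.dist_eq]
  exact max_lt (by rwa [Real.dist_eq]) hw

-- Turns an estimate for increments of the flow map into one for its Jacobian matrix.
omit [FiniteDimensional ℝ E] [MeasurableSpace E] [BorelSpace E] in
theorem norm_fderiv_sub_one_le {ψ : E → E} {C : ℝ} (hC : 0 ≤ C)
    {B : E →L[ℝ] E} {x : E} (hd : DifferentiableAt ℝ ψ x)
    (h : ∀ᶠ y in 𝓝 x, ‖ψ y - ψ x - (y - x) - B (y - x)‖ ≤ C * ‖y - x‖) :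
    ‖fderiv ℝ ψ x - 1 - B‖ ≤ C := by
  have h1 : HasFDerivAt (fun y => ψ y - y - B y) (fderiv ℝ ψ x - 1 - B) x :=
    (hd.hasFDerivAt.sub (hasFDerivAt_id x)).sub B.hasFDerivAt
  refine h1.le_of_lip' hC ?_
  filter_upwards [h] with y hy
  convert hy using 2
  rw [map_sub]
  abel

/-- **Reynolds' transport theorem** on a compact time interval. -/
theorem hasDerivWithinAt_integral_of_trajectories {a b t : ℝ} (hab : a < b) (ht : t ∈ Icc a b)
    {v : ℝ → E → E} (hv : ContDiffOn ℝ 1 (fun z : ℝ × E => v z.1 z.2) (Icc a b ×ˢ univ))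
    {f : ℝ → E → ℝ} (hf : ContDiffOn ℝ 1 (fun z : ℝ × E => f z.1 z.2) (Icc a b ×ˢ univ))
    {V : ℝ → Set E} (hVo : IsOpen (V t)) (hVb : Bornology.IsBounded (V t))
    (hfwd : ∀ x ∈ V t, ∃ z : ℝ → E, z t = x ∧
      (∀ τ ∈ Icc a b, HasDerivWithinAt z (v τ (z τ)) (Icc a b) τ) ∧ ∀ s ∈ Icc a b, z s ∈ V s)
    (hbwd : ∀ s ∈ Icc a b, ∀ y ∈ V s, ∃ z : ℝ → E, z s = y ∧
      (∀ τ ∈ Icc a b, HasDerivWithinAt z (v τ (z τ)) (Icc a b) τ) ∧ z t ∈ V t)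
    {f' : E → ℝ × E →L[ℝ] ℝ} (hf' : ∀ x ∈ V t, HasFDerivWithinAt (fun z : ℝ × E => f z.1 z.2)
      (f' x) (Icc a b ×ˢ univ) (t, x)) :
    HasDerivWithinAt (fun s => ∫ x in V s, f s x)
      (∫ x in V t, (f' x (1, v t x) + f t x * LinearMap.trace ℝ E (fderiv ℝ (v t) x)))
      (Icc a b) t := by
  classical
  obtain ⟨R, hR⟩ := hVb.exists_norm_le
  set Q : Set (ℝ × E) := Icc a b ×ˢ Metric.closedBall (0 : E) (R + 1) with hQ
  have hQc : IsCompact Q := isCompact_Icc.prod (isCompact_closedBall _ _)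
  have hQs : Q ⊆ Icc a b ×ˢ univ := prod_mono subset_rfl (subset_univ _)
  have hQx : Convex ℝ Q := (convex_Icc a b).prod (convex_closedBall _ _)
  have hQm : ∀ {τ x}, τ ∈ Icc a b → ‖x‖ ≤ R + 1 → (τ, x) ∈ Q := fun hτ hx =>
    ⟨hτ, mem_closedBall_zero_iff.2 hx⟩
  have hJ : (Icc a b).OrdConnected := ordConnected_Icc
  obtain ⟨M₀, hM₀⟩ := hQc.exists_bound_of_continuousOn (hv.continuousOn.mono hQs)
  obtain ⟨Cf, hCf⟩ := hQc.exists_bound_of_continuousOn (hf.continuousOn.mono hQs)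
  obtain ⟨Lv, hLv⟩ := (hv.mono hQs).exists_lipschitzOnWith one_ne_zero hQx hQc
  obtain ⟨Kf, hKf⟩ := (hf.mono hQs).exists_lipschitzOnWith one_ne_zero hQx hQc
  set M := |M₀| + 1 with hMdef
  have hMpos : 0 < M := by positivity
  have hM : ∀ τ ∈ Icc a b, ∀ x, ‖x‖ ≤ R + 1 → ‖v τ x‖ < M := fun τ hτ x hx =>
    lt_of_le_of_lt (hM₀ (τ, x) (hQm hτ hx)) (by rw [hMdef]; linarith [le_abs_self M₀])
  obtain ⟨L, hLdef⟩ : ∃ L : ℝ, L = (Lv : ℝ) := ⟨_, rfl⟩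
  have hL0 : 0 ≤ L := hLdef ▸ Lv.2
  have hL : ∀ τ ∈ Icc a b, ∀ x y, ‖x‖ ≤ R + 1 → ‖y‖ ≤ R + 1 → ‖v τ x - v τ y‖ ≤ L * ‖x - y‖ :=
    fun τ hτ x y hx hy => by
      have := hLv.dist_le_mul (τ, x) (hQm hτ hx) (τ, y) (hQm hτ hy)
      rw [Prod.dist_eq, ← hLdef] at this
      simpa [dist_eq_norm] using this
  -- `Z x s` is the position at time s of the particle that is at x at time t.
  choose! Z hZt hZd hZV using hfwd
  set A : E → E →L[ℝ] E := fun x => fderiv ℝ (v t) x with hA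
  have hvt : ContDiff ℝ 1 (v t) := contDiff_slice_of_contDiffOn hv ht
  have hAc : Continuous A := hvt.continuous_fderiv one_ne_zero
  have hAL : ∀ x ∈ V t, ‖A x‖ ≤ L := fun x hx => by
    refine (hvt.differentiable one_ne_zero x).hasFDerivAt.le_of_lip' hL0 ?_
    filter_upwards [hVo.mem_nhds hx] with y hy
    exact hL t ht y x (by linarith [hR y hy]) (by linarith [hR x hx])
  obtain ⟨D, hD, hDtr⟩ := hasFDerivAt_continuousLinearMap_det_one (E := E)
  obtain ⟨Cd, hCd0, hCd⟩ := hD.isBigO_sub.exists_pos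
  obtain ⟨η, hη, hηd⟩ := Metric.eventually_nhds_iff_ball.1 hCd.bound
  have hdet1 : (1 : E →L[ℝ] E).det = 1 := by
    rw [ContinuousLinearMap.det]
    exact LinearMap.det_id
  -- For |s − t| < 1/B particles stay in the ball of radius R + 1, the flow differs from the
  -- identity by a map with Lipschitz constant at most 1/2, and the Jacobian matrix stays in the
  -- η-ball around 1 where the determinant is controlled.
  set B := M + 4 * L + 2 * L / η + 1 with hBdef
  have hBpos : 0 < B := by positivity
  have hsmall : ∀ s : ℝ, |s - t| < 1 / B → M * |s - t| ≤ 1 ∧ 4 * L * |s - t| ≤ 1 ∧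
      2 * L * |s - t| < η := fun s hs => by
    rw [lt_div_iff₀ hBpos] at hs
    have h0 := abs_nonneg (s - t)
    have h1 : 0 ≤ 4 * L * |s - t| := by positivity
    have h2 : 0 ≤ M * |s - t| := by positivity
    have h3 : 0 ≤ 2 * L / η * |s - t| := by positivity
    rw [hBdef] at hs
    refine ⟨by nlinarith, by nlinarith, ?_⟩
    have h4 : 2 * L / η * |s - t| < 1 := by nlinarith
    have h5 : 2 * L / η * |s - t| = 2 * L * |s - t| / η := by ring
    rw [h5, div_lt_one hη] at h4
    exact h4
  have hZt' : ∀ x ∈ V t, ‖Z x t‖ ≤ R := fun x hx => by rw [hZt x hx]; exact hR x hx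
  have hZR : ∀ s ∈ Icc a b, |s - t| < 1 / B → ∀ x ∈ V t, ‖Z x s‖ ≤ R + 1 ∧
      ‖Z x s - x‖ ≤ M * |s - t| := fun s hs hst x hx => by
    refine ⟨norm_trajectory_le hJ ht hs (hZd x hx) (hZt' x hx) hM (hsmall s hst).1, ?_⟩
    have := norm_trajectory_sub_le hJ ht hs (hZd x hx) (hZt' x hx) hM (hsmall s hst).1
    rwa [hZt x hx] at this
  have hZL : ∀ s ∈ Icc a b, |s - t| < 1 / B → ∀ x ∈ V t, ∀ y ∈ V t,
      ‖Z x s - Z y s‖ ≤ 2 * ‖x - y‖ ∧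
      ‖Z x s - Z y s - (x - y)‖ ≤ 2 * L * |s - t| * ‖x - y‖ := fun s hs hst x hx y hy => by
    have h1 := (hsmall s hst).2.1
    have h2 : 0 ≤ L * |s - t| := by positivity
    have := norm_trajectory_sub_trajectory_le hJ ht hs (hZd x hx) (hZt' x hx) (hZd y hy)
      (hZt' y hy) hM (hsmall s hst).1 hL0 hL (by linarith)
    rwa [hZt x hx, hZt y hy] at this
  -- The Jacobian matrix of the flow. Where it does not exist, the linearization is used instead;
  -- this exceptional set is null for each s near t but may depend on s, and the choice makes s ↦ `N
  -- s x` differentiable at t for every x.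
  set N : ℝ → E → E →L[ℝ] E := fun s x =>
    if DifferentiableAt ℝ (fun y => Z y s) x then fderiv ℝ (fun y => Z y s) x
    else 1 + (s - t) • A x with hN
  have hNt : ∀ x ∈ V t, N t x = 1 := fun x hx => by
    have h1 : (fun y => Z y t) =ᶠ[𝓝 x] fun y => y := by
      filter_upwards [hVo.mem_nhds hx] with y hy using hZt y hy
    have h2 : DifferentiableAt ℝ (fun y => Z y t) x := differentiableAt_id.congr_of_eventuallyEq h1
    simp only [hN, if_pos h2]
    rw [h1.fderiv_eq]
    exact fderiv_id
  have hNle : ∀ s ∈ Icc a b, |s - t| < 1 / B → ∀ x ∈ V t, ‖N s x - 1‖ ≤ 2 * L * |s - t| :=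
    fun s hs hst x hx => by
      have h0 : 0 ≤ 2 * L * |s - t| := by positivity
      by_cases hd : DifferentiableAt ℝ (fun y => Z y s) x
      · simp only [hN, if_pos hd]
        have := norm_fderiv_sub_one_le (B := 0) h0 hd (by
          filter_upwards [hVo.mem_nhds hx] with y hy
          simpa using (hZL s hs hst y hy x hx).2)
        simpa using this
      · simp only [hN, if_neg hd, add_sub_cancel_left, norm_smul, Real.norm_eq_abs]
        have := mul_le_mul_of_nonneg_left (hAL x hx) (abs_nonneg (s - t))
        have h3 : 0 ≤ L * |s - t| := by positivity
        linarith
  have hdetle : ∀ s ∈ Icc a b, |s - t| < 1 / B → ∀ x ∈ V t,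
      |(|(N s x).det|) - 1| ≤ Cd * (2 * L * |s - t|) := fun s hs hst x hx => by
    have h1 := hNle s hs hst x hx
    have h2 := hηd (N s x) (by
      rw [mem_ball_iff_norm]
      exact h1.trans_lt (hsmall s hst).2.2)
    rw [hdet1, Real.norm_eq_abs] at h2
    have h3 := abs_abs_sub_abs_le_abs_sub (N s x).det 1
    rw [abs_one] at h3
    exact h3.trans (h2.trans (mul_le_mul_of_nonneg_left h1 hCd0.le))
  set F : ℝ → E → ℝ := fun s x => |(N s x).det| * f s (Z x s) with hF
  have hFt : ∀ x ∈ V t, F t x = f t x := fun x hx => by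
    simp only [hF, hNt x hx, hdet1, hZt x hx, abs_one, one_mul]
  have hcv : ∀ s ∈ Icc a b, |s - t| < 1 / B → ∫ x in V s, f s x = ∫ x in V t, F s x :=
    fun s hs hst => by
      have him : (fun y => Z y s) '' V t = V s := by
        ext y
        constructor
        · rintro ⟨x, hx, rfl⟩
          exact hZV x hx s hs
        · intro hy
          -- Surjectivity: follow y back to time t; by uniqueness that trajectory agrees at time s
          -- with the chosen one through the same point.
          obtain ⟨z, hzs, hzd, hzt⟩ := hbwd s hs y hy
          have h1 := (hsmall s hst).2.1
          have h2 : 0 ≤ L * |s - t| := by positivity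
          have := (norm_trajectory_sub_trajectory_le hJ ht hs (hZd _ hzt) (hZt' _ hzt) hzd
            (hR _ hzt) hM (hsmall s hst).1 hL0 hL (by linarith)).1
          rw [hZt _ hzt, sub_self, norm_zero, mul_zero, norm_le_zero_iff, sub_eq_zero] at this
          exact ⟨z t, hzt, this.trans hzs⟩
      rw [← him]
      refine integral_image_eq_integral_abs_det_of_lipschitzOnWith hVo (K := 2)
        (LipschitzOnWith.of_dist_le_mul fun x hx y hy => ?_) (fun x hx y hy hxy => ?_)
        (fun x hx hd => by simp only [hN, if_pos hd]) _
      · rw [dist_eq_norm, dist_eq_norm]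
        exact (hZL s hs hst x hx y hy).1
      -- Injectivity: equal images would give ‖x − y‖ ≤ ½‖x − y‖.
      · have h1 := (hZL s hs hst x hx y hy).2
        have hxy' : Z x s = Z y s := hxy
        rw [hxy', sub_self, zero_sub, norm_neg] at h1
        have h2 := (hsmall s hst).2.1
        have h3 := mul_le_mul_of_nonneg_right h2 (norm_nonneg (x - y))
        have h4 := norm_nonneg (x - y)
        have h5 : ‖x - y‖ = 0 := by nlinarith
        exact sub_eq_zero.1 (norm_eq_zero.1 h5)
  have hFm : ∀ s ∈ Icc a b, |s - t| < 1 / B →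
      AEStronglyMeasurable (F s) (volume.restrict (V t)) := fun s hs hst => by
    have h1 : Measurable (N s) :=
      Measurable.ite (measurableSet_of_differentiableAt ℝ _) (measurable_fderiv ℝ _)
        (by fun_prop : Continuous fun x => (1 : E →L[ℝ] E) + (s - t) • A x).measurable
    have h2 : Measurable fun x => |(N s x).det| :=
      continuous_abs.measurable.comp (ContinuousLinearMap.continuous_det.measurable.comp h1)
    have h3 : ContinuousOn (fun x => Z x s) (V t) :=
      (LipschitzOnWith.of_dist_le_mul (K := 2) fun x hx y hy => by
        rw [dist_eq_norm, dist_eq_norm]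
        exact (hZL s hs hst x hx y hy).1).continuousOn
    have h4 : ContinuousOn (fun x => f s (Z x s)) (V t) :=
      (contDiff_slice_of_contDiffOn hf hs).continuous.comp_continuousOn h3
    exact h2.aestronglyMeasurable.mul (h4.aestronglyMeasurable hVo.measurableSet)
  have hVfin : volume (V t) < ⊤ := hVb.measure_lt_top
  have hCf0 : 0 ≤ |Cf| := abs_nonneg _
  set C := Cd * (2 * L) * |Cf| + Kf * (1 + M) with hC
  -- In `C` the first term comes from the determinant, the second from `f` along the trajectory.
  -- This uniform bound dominates the difference quotients.
  have hFlip : ∀ s ∈ Icc a b, |s - t| < 1 / B → ∀ x ∈ V t, |F s x - F t x| ≤ C * |s - t| :=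
    fun s hs hst x hx => by
      have h1 := hdetle s hs hst x hx
      have hZ := hZR s hs hst x hx
      have h2 : |f s (Z x s)| ≤ |Cf| := (hCf (s, Z x s) (hQm hs hZ.1)).trans (le_abs_self _)
      have h3 : |f s (Z x s) - f t x| ≤ Kf * ((1 + M) * |s - t|) := by
        have := hKf.dist_le_mul (s, Z x s) (hQm hs hZ.1) (t, x) (hQm ht (by linarith [hR x hx]))
        rw [Prod.dist_eq, Real.dist_eq] at this
        refine this.trans (mul_le_mul_of_nonneg_left (max_le ?_ ?_) Kf.2)
        · simp only [Real.dist_eq]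
          nlinarith [abs_nonneg (s - t), mul_nonneg hMpos.le (abs_nonneg (s - t))]
        · simp only [dist_eq_norm]
          nlinarith [abs_nonneg (s - t), hZ.2]
      rw [hFt x hx]
      have h4 : F s x - f t x
          = (|(N s x).det| - 1) * f s (Z x s) + (f s (Z x s) - f t x) := by
        simp only [hF]; ring
      rw [h4]
      refine (abs_add_le _ _).trans ?_
      rw [abs_mul]
      have h5 := mul_le_mul h1 h2 (abs_nonneg _) (by positivity)
      rw [hC]
      nlinarith
  have hFint : ∀ s ∈ Icc a b, |s - t| < 1 / B → IntegrableOn (F s) (V t) := fun s hs hst => by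
    refine IntegrableOn.of_bound hVfin (hFm s hs hst) (|Cf| + C * |s - t|) ?_
    refine (ae_restrict_iff' hVo.measurableSet).2 (Eventually.of_forall fun x hx => ?_)
    have h1 := hFlip s hs hst x hx
    have h2 : |F t x| ≤ |Cf| := by
      rw [hFt x hx]
      exact (hCf (t, x) (hQm ht (by linarith [hR x hx]))).trans (le_abs_self _)
    have h3 := abs_add_le (F t x) (F s x - F t x)
    rw [add_sub_cancel] at h3
    rw [Real.norm_eq_abs]
    linarith
  have hder : ∀ x ∈ V t, HasDerivWithinAt (fun s => F s x)
      (f' x (1, v t x) + f t x * LinearMap.trace ℝ E (fderiv ℝ (v t) x)) (Icc a b) t :=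
    fun x hx => by
      have hNd : HasDerivWithinAt (fun s => N s x) (A x) (Icc a b) t := by
        rw [hasDerivWithinAt_iff_isLittleO, Asymptotics.isLittleO_iff]
        intro ε hε
        obtain ⟨δ, hδ, h⟩ := exists_norm_trajectory_sub_trajectory_sub_le hJ ht hM hL0 hL
          (fun ε hε => exists_norm_sub_sub_fderiv_le hab ht hv x hε) hε
        filter_upwards [self_mem_nhdsWithin, nhdsWithin_le_nhds (Metric.ball_mem_nhds t hδ)]
          with s hs hst
        rw [Metric.mem_ball, Real.dist_eq] at hst
        rw [hNt x hx, Real.norm_eq_abs]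
        by_cases hd : DifferentiableAt ℝ (fun y => Z y s) x
        · simp only [hN, if_pos hd]
          refine norm_fderiv_sub_one_le (by positivity) hd ?_
          filter_upwards [hVo.mem_nhds hx, Metric.ball_mem_nhds x hδ] with y hy hyx
          have := h s hs hst (Z y) (Z x) (hZd y hy) (hZt' y hy) (by rwa [hZt y hy]) (hZd x hx)
            (hZt' x hx) (by rw [hZt x hx]; exact Metric.mem_ball_self hδ)
          rw [hZt x hx, hZt y hy] at this
          exact this
        · simp only [hN, if_neg hd, add_sub_cancel_left, sub_self, norm_zero]
          positivity
      have hdet : HasDerivWithinAt (fun s => |(N s x).det|) (D (A x)) (Icc a b) t := by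
        have h1 : HasFDerivAt (fun A : E →L[ℝ] E => A.det) D (N t x) := by rwa [hNt x hx]
        have h2 := h1.comp_hasDerivWithinAt t hNd
        have h3 : HasDerivAt (fun r : ℝ => |r|) 1 ((N t x).det) :=
          hasDerivAt_abs_pos (by rw [hNt x hx, hdet1]; exact one_pos)
        have h4 := h3.comp_hasDerivWithinAt t h2
        rw [one_mul] at h4
        exact h4
      have hfz : HasDerivWithinAt (fun s => f s (Z x s)) (f' x (1, v t x)) (Icc a b) t := by
        have h1 : HasDerivWithinAt (fun s => (s, Z x s)) (1, v t (Z x t)) (Icc a b) t :=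
          (hasDerivWithinAt_id t _).prodMk (hZd x hx t ht)
        rw [hZt x hx] at h1
        have h2 : HasFDerivWithinAt (fun z : ℝ × E => f z.1 z.2) (f' x) (Icc a b ×ˢ univ)
            ((fun s => (s, Z x s)) t) := by
          simpa only [hZt x hx] using hf' x hx
        exact h2.comp_hasDerivWithinAt t h1
          (show MapsTo (fun s => (s, Z x s)) (Icc a b) (Icc a b ×ˢ univ) from
            fun s hs => ⟨hs, mem_univ _⟩)
      have := hdet.mul hfz
      convert! this using 1
      rw [hNt x hx, hdet1, hZt x hx, abs_one, hDtr]
      ring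
  rw [hasDerivWithinAt_iff_tendsto_slope]
  have hnear : ∀ᶠ s in 𝓝[Icc a b \ {t}] t, s ∈ Icc a b ∧ |s - t| < 1 / B := by
    filter_upwards [self_mem_nhdsWithin, nhdsWithin_le_nhds (Metric.ball_mem_nhds t
      (by positivity : 0 < 1 / B))] with s hs hst
    exact ⟨hs.1, by rwa [Metric.mem_ball, Real.dist_eq] at hst⟩
  have ht0 : |t - t| < 1 / B := by rw [sub_self, abs_zero]; positivity
  have hslope : ∀ᶠ s in 𝓝[Icc a b \ {t}] t, (∫ x in V t, slope (fun s => F s x) t s)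
      = slope (fun s => ∫ x in V s, f s x) t s := by
    filter_upwards [hnear] with s hs
    simp only [slope_def_module]
    rw [hcv s hs.1 hs.2, hcv t ht ht0, integral_smul,
      integral_sub (hFint s hs.1 hs.2) (hFint t ht ht0)]
  refine Tendsto.congr' hslope ?_
  refine tendsto_integral_filter_of_dominated_convergence (fun _ => C) ?_ ?_ ?_ ?_
  · filter_upwards [hnear] with s hs
    simp only [slope_def_module]
    exact ((hFm s hs.1 hs.2).sub (hFm t ht ht0)).const_smul (s - t)⁻¹
  · filter_upwards [hnear, self_mem_nhdsWithin] with s hs hst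
    refine (ae_restrict_iff' hVo.measurableSet).2 (Eventually.of_forall fun x hx => ?_)
    have h1 := hFlip s hs.1 hs.2 x hx
    have h2 : 0 < |s - t| := abs_pos.2 (sub_ne_zero.2 hst.2)
    rw [slope_def_module, norm_smul, norm_inv, Real.norm_eq_abs, Real.norm_eq_abs,
      inv_mul_le_iff₀ h2]
    linarith
  · exact integrableOn_const (hs := hVfin.ne)
  · refine (ae_restrict_iff' hVo.measurableSet).2 (Eventually.of_forall fun x hx => ?_)
    exact hasDerivWithinAt_iff_tendsto_slope.1 (hder x hx)

-- Localizes to a compact time interval, where uniform bounds are available. An end point equals `t`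
-- only if `t` is an end point of `I`, and the non-empty interior excludes that both do.
omit [MeasurableSpace E] [BorelSpace E] in
theorem exists_Icc_subset_mem_nhdsWithin {I : Set ℝ} (hI : I.OrdConnected)
    (hI' : (interior I).Nonempty) {t : ℝ} (ht : t ∈ I) :
    ∃ a b, a < b ∧ t ∈ Icc a b ∧ Icc a b ⊆ I ∧ Icc a b ∈ 𝓝[I] t := by
  have hlow : ∃ a ∈ I, a ≤ t ∧ (∀ᶠ s in 𝓝[I] t, a ≤ s) ∧ (a = t → ∀ s ∈ I, t ≤ s) := by
    by_cases h : ∃ a ∈ I, a < t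
    · obtain ⟨a, ha, hat⟩ := h
      exact ⟨a, ha, hat.le, nhdsWithin_le_nhds (eventually_ge_nhds hat), fun h => absurd h hat.ne⟩
    · push Not at h
      exact ⟨t, ht, le_rfl, eventually_mem_nhdsWithin.mono h, fun _ => h⟩
  have hupp : ∃ b ∈ I, t ≤ b ∧ (∀ᶠ s in 𝓝[I] t, s ≤ b) ∧ (t = b → ∀ s ∈ I, s ≤ t) := by
    by_cases h : ∃ b ∈ I, t < b
    · obtain ⟨b, hb, hbt⟩ := h
      exact ⟨b, hb, hbt.le, nhdsWithin_le_nhds (eventually_le_nhds hbt), fun h => absurd h hbt.ne⟩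
    · push Not at h
      exact ⟨t, ht, le_rfl, eventually_mem_nhdsWithin.mono h, fun _ => h⟩
  obtain ⟨a, ha, hat, ha1, ha2⟩ := hlow
  obtain ⟨b, hb, hbt, hb1, hb2⟩ := hupp
  refine ⟨a, b, lt_of_le_of_ne (hat.trans hbt) fun hab => ?_, ⟨hat, hbt⟩, hI.out ha hb,
    (ha1.and hb1).mono fun s hs => hs⟩
  have h1 : a = t := le_antisymm hat (hab ▸ hbt)
  have h2 : t = b := h1 ▸ hab
  have h3 : I ⊆ {t} := fun s hs => le_antisymm (hb2 h2 s hs) (ha2 h1 s hs)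
  have h4 := interior_mono h3
  rw [interior_singleton] at h4
  exact hI'.ne_empty (eq_empty_of_subset_empty h4)

end Transport

/-! ### Transport of material volumes. -/

section MaterialVolume

variable {n : ℕ} {I : Set ℝ} {v : ℝ → EuclideanSpace ℝ (Fin n) → EuclideanSpace ℝ (Fin n)}
  {V : ℝ → Set (EuclideanSpace ℝ (Fin n))}

/-- **Reynolds' transport theorem** for a material volume. -/
theorem IsMaterialVolume.hasDerivWithinAt_integral (hmat : IsMaterialVolume I v V)
    (hI : I.OrdConnected) (hI' : (interior I).Nonempty)
    (hv : ContDiffOn ℝ 1 (fun z : ℝ × EuclideanSpace ℝ (Fin n) => v z.1 z.2) (I ×ˢ univ))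
    {f : ℝ → EuclideanSpace ℝ (Fin n) → ℝ}
    (hf : ContDiffOn ℝ 1 (fun z : ℝ × EuclideanSpace ℝ (Fin n) => f z.1 z.2) (I ×ˢ univ))
    {t : ℝ} (ht : t ∈ I) (hVo : IsOpen (V t)) (hVb : Bornology.IsBounded (V t)) :
    HasDerivWithinAt (fun s => ∫ x in V s, f s x)
      (∫ x in V t, (fderivWithin ℝ (fun z : ℝ × EuclideanSpace ℝ (Fin n) => f z.1 z.2)
        (I ×ˢ univ) (t, x) (1, v t x)
        + f t x * LinearMap.trace ℝ (EuclideanSpace ℝ (Fin n)) (fderiv ℝ (v t) x))) I t := by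
  obtain ⟨a, b, hab, htab, hsub, hnhds⟩ := exists_Icc_subset_mem_nhdsWithin hI hI' ht
  have hsub' : Icc a b ×ˢ (univ : Set (EuclideanSpace ℝ (Fin n))) ⊆ I ×ˢ univ :=
    prod_mono hsub subset_rfl
  refine (hasDerivWithinAt_integral_of_trajectories hab htab (hv.mono hsub') (hf.mono hsub')
    hVo hVb (fun x hx => ?_) (fun s hs y hy => ?_)
    (fun x hx => ((hf.differentiableOn one_ne_zero (t, x)
      ⟨ht, mem_univ _⟩).hasFDerivWithinAt).mono hsub')).mono_of_mem_nhdsWithin hnhds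
  · obtain ⟨z, hz, hzd, hzV⟩ := hmat t ht x (subset_closure hx)
    exact ⟨z, hz, fun τ hτ => (hzd τ (hsub hτ)).mono hsub, fun s hs => hzV hx s (hsub hs)⟩
  · obtain ⟨z, hz, hzd, hzV⟩ := hmat s (hsub hs) y (subset_closure hy)
    exact ⟨z, hz, fun τ hτ => (hzd τ (hsub hτ)).mono hsub, hzV hy t ht⟩

/-- A material volume stays in a given neighbourhood of its initial closure for a short time. -/
theorem IsMaterialVolume.eventually_subset (hmat : IsMaterialVolume I v V)
    (hI : I.OrdConnected) (hI' : (interior I).Nonempty)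
    (hv : ContDiffOn ℝ 1 (fun z : ℝ × EuclideanSpace ℝ (Fin n) => v z.1 z.2) (I ×ˢ univ))
    {t : ℝ} (ht : t ∈ I) (hVb : Bornology.IsBounded (V t))
    {O : Set (EuclideanSpace ℝ (Fin n))} (hO : IsOpen O) (hVO : closure (V t) ⊆ O) :
    ∀ᶠ s in 𝓝[I] t, V s ⊆ O := by
  obtain ⟨a, b, hab, htab, hsub, hnhds⟩ := exists_Icc_subset_mem_nhdsWithin hI hI' ht
  obtain ⟨R, hR⟩ := hVb.exists_norm_le
  have hQc : IsCompact (Icc a b ×ˢ Metric.closedBall (0 : EuclideanSpace ℝ (Fin n)) (R + 1)) :=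
    isCompact_Icc.prod (isCompact_closedBall _ _)
  obtain ⟨M₀, hM₀⟩ := hQc.exists_bound_of_continuousOn
    (hv.continuousOn.mono (prod_mono hsub (subset_univ _)))
  have hM : ∀ τ ∈ Icc a b, ∀ x, ‖x‖ ≤ R + 1 → ‖v τ x‖ < |M₀| + 1 := fun τ hτ x hx =>
    lt_of_le_of_lt (hM₀ (τ, x) ⟨hτ, mem_closedBall_zero_iff.2 hx⟩) (by linarith [le_abs_self M₀])
  obtain ⟨δ, hδ, hδO⟩ := hVb.isCompact_closure.exists_thickening_subset_open hO hVO
  have hlim : Tendsto (fun s => (|M₀| + 1) * |s - t|) (𝓝[I] t) (𝓝 0) := by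
    have : Continuous fun s => (|M₀| + 1) * |s - t| := by fun_prop
    simpa using (this.tendsto t).mono_left nhdsWithin_le_nhds
  filter_upwards [hnhds, hlim.eventually_lt_const hδ, hlim.eventually_le_const one_pos]
    with s hs hsδ hs1 y hy
  -- Each point of `V s` is traced back to `V t`, at a distance of at most (|M₀| + 1)|s − t|.
  obtain ⟨z, hz, hzd, hzV⟩ := hmat s (hsub hs) y (subset_closure hy)
  have h1 := norm_trajectory_sub_le ordConnected_Icc htab hs
    (fun τ hτ => (hzd τ (hsub hτ)).mono hsub) (hR _ (hzV hy t ht)) hM hs1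
  refine hδO (Metric.mem_thickening_iff.2 ⟨z t, subset_closure (hzV hy t ht), ?_⟩)
  rw [← hz, dist_eq_norm]
  exact h1.trans_lt hsδ

end MaterialVolume

/-! ### Balance laws for mass and momentum in integral form. -/

section GasDynamics

variable {n : ℕ}

theorem euclideanSpace_eq_sum_single (u : EuclideanSpace ℝ (Fin n)) :
    u = ∑ j, u j • EuclideanSpace.single j (1 : ℝ) := by
  ext i
  simp [Pi.single_apply]

theorem clm_apply_eq_sum_single {F : Type*} [NormedAddCommGroup F] [NormedSpace ℝ F]
    (A : EuclideanSpace ℝ (Fin n) →L[ℝ] F) (u : EuclideanSpace ℝ (Fin n)) :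
    A u = ∑ j, u j • A (EuclideanSpace.single j 1) := by
  conv_lhs => rw [euclideanSpace_eq_sum_single u]
  simp [map_sum]

theorem trace_eq_sum_single (A : EuclideanSpace ℝ (Fin n) →L[ℝ] EuclideanSpace ℝ (Fin n)) :
    LinearMap.trace ℝ (EuclideanSpace ℝ (Fin n)) A = ∑ j, A (EuclideanSpace.single j 1) j := by
  rw [LinearMap.trace_eq_matrix_trace ℝ (EuclideanSpace.basisFun (Fin n) ℝ).toBasis]
  simp [Matrix.trace, LinearMap.toMatrix_apply]

/-- The divergence of a scalar function times a vector field. -/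
theorem sum_partialDeriv_mul {w : EuclideanSpace ℝ (Fin n) → ℝ}
    {u : EuclideanSpace ℝ (Fin n) → EuclideanSpace ℝ (Fin n)} {x : EuclideanSpace ℝ (Fin n)}
    (hw : DifferentiableAt ℝ w x) (hu : DifferentiableAt ℝ u x) :
    ∑ j, partialDeriv j (fun y => w y * u y j) x
      = fderiv ℝ w x (u x) + w x * LinearMap.trace ℝ (EuclideanSpace ℝ (Fin n)) (fderiv ℝ u x) := by
  rw [clm_apply_eq_sum_single (fderiv ℝ w x), trace_eq_sum_single, Finset.mul_sum,
    ← Finset.sum_add_distrib]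
  refine Finset.sum_congr rfl fun j _ => ?_
  have h1 : HasFDerivAt (fun y => u y j) ((EuclideanSpace.proj j).comp (fderiv ℝ u x)) x :=
    (EuclideanSpace.proj (𝕜 := ℝ) j).hasFDerivAt.comp x hu.hasFDerivAt
  have h2 := (hw.hasFDerivAt.mul h1).fderiv
  have h3 : partialDeriv j (fun y => w y * u y j) x
      = fderiv ℝ (w * fun y => u y j) x (EuclideanSpace.single j 1) := rfl
  rw [h3, h2]
  simp
  ring

/-- The derivative of `g` along the trajectories of the velocity field `v`. -/
noncomputable def materialDeriv (I : Set ℝ)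
    (v : ℝ → EuclideanSpace ℝ (Fin n) → EuclideanSpace ℝ (Fin n))
    (g : ℝ → EuclideanSpace ℝ (Fin n) → ℝ) (t : ℝ) (x : EuclideanSpace ℝ (Fin n)) : ℝ :=
  fderivWithin ℝ (fun z : ℝ × EuclideanSpace ℝ (Fin n) => g z.1 z.2) (I ×ˢ univ) (t, x) (1, v t x)

variable {I : Set ℝ} {v : ℝ → EuclideanSpace ℝ (Fin n) → EuclideanSpace ℝ (Fin n)}
  {g h : ℝ → EuclideanSpace ℝ (Fin n) → ℝ} {t : ℝ} {x : EuclideanSpace ℝ (Fin n)}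

theorem materialDeriv_eq (hI : UniqueDiffOn ℝ I) (ht : t ∈ I)
    (hg : DifferentiableOn ℝ (fun z : ℝ × EuclideanSpace ℝ (Fin n) => g z.1 z.2) (I ×ˢ univ)) :
    materialDeriv I v g t x = derivWithin (fun τ => g τ x) I t + fderiv ℝ (g t) x (v t x) := by
  have hd := (hg (t, x) ⟨ht, mem_univ _⟩).hasFDerivWithinAt
  have h1 : HasDerivWithinAt (fun τ => g τ x) _ I t :=
    HasFDerivWithinAt.comp_hasDerivWithinAt (f := fun τ => (τ, x)) t hd
      ((hasDerivWithinAt_id t I).prodMk (hasDerivWithinAt_const t I x))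
      (show MapsTo (fun τ => (τ, x)) I (I ×ˢ univ) from fun s hs => ⟨hs, mem_univ _⟩)
  rw [materialDeriv, h1.derivWithin (hI t ht), (hasFDerivAt_slice_of_hasFDerivWithinAt ht hd).fderiv,
    ContinuousLinearMap.comp_apply, ← map_add]
  simp

theorem materialDeriv_mul (hI : UniqueDiffOn ℝ I) (ht : t ∈ I)
    (hg : DifferentiableOn ℝ (fun z : ℝ × EuclideanSpace ℝ (Fin n) => g z.1 z.2) (I ×ˢ univ))
    (hh : DifferentiableOn ℝ (fun z : ℝ × EuclideanSpace ℝ (Fin n) => h z.1 z.2) (I ×ˢ univ)) :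
    materialDeriv I v (fun τ y => g τ y * h τ y) t x
      = g t x * materialDeriv I v h t x + h t x * materialDeriv I v g t x := by
  have hx : (t, x) ∈ I ×ˢ (univ : Set (EuclideanSpace ℝ (Fin n))) := ⟨ht, mem_univ _⟩
  have h1 := ((hg _ hx).hasFDerivWithinAt.mul (hh _ hx).hasFDerivWithinAt).fderivWithin
    ((hI.prod uniqueDiffOn_univ) _ hx)
  unfold materialDeriv
  refine (DFunLike.congr_fun h1 (1, v t x)).trans ?_
  simp

theorem materialDeriv_sum (hI : UniqueDiffOn ℝ I) (ht : t ∈ I) {ι : Type*} [Fintype ι]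
    {G : ι → ℝ → EuclideanSpace ℝ (Fin n) → ℝ}
    (hG : ∀ i, DifferentiableOn ℝ (fun z : ℝ × EuclideanSpace ℝ (Fin n) => G i z.1 z.2)
      (I ×ˢ univ)) :
    materialDeriv I v (fun τ y => ∑ i, G i τ y) t x = ∑ i, materialDeriv I v (G i) t x := by
  have hx : (t, x) ∈ I ×ˢ (univ : Set (EuclideanSpace ℝ (Fin n))) := ⟨ht, mem_univ _⟩
  have h1 := (HasFDerivWithinAt.fun_sum (u := Finset.univ)
    fun i _ => (hG i _ hx).hasFDerivWithinAt).fderivWithin ((hI.prod uniqueDiffOn_univ) _ hx)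
  unfold materialDeriv
  refine (DFunLike.congr_fun h1 (1, v t x)).trans ?_
  simp

theorem materialDeriv_const_time (hI : UniqueDiffOn ℝ I) (ht : t ∈ I)
    {a : EuclideanSpace ℝ (Fin n) → ℝ} (ha : Differentiable ℝ a) :
    materialDeriv I v (fun _ => a) t x = fderiv ℝ a x (v t x) := by
  rw [materialDeriv_eq hI ht (ha.comp differentiable_snd).differentiableOn]
  simp

theorem Continuous.integrableOn_of_isBounded {F : EuclideanSpace ℝ (Fin n) → ℝ} (hF : Continuous F)
    {U : Set (EuclideanSpace ℝ (Fin n))} (hU : Bornology.IsBounded U) : IntegrableOn F U :=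
  (hF.continuousOn.integrableOn_compact hU.isCompact_closure).mono_set subset_closure

namespace IsGDSolution

variable {γ : ℝ} {ρ p : ℝ → EuclideanSpace ℝ (Fin n) → ℝ}

theorem contDiffOn_momentum (hsol : IsGDSolution γ I ρ v p) (i : Fin n) :
    ContDiffOn ℝ 1 (fun z : ℝ × EuclideanSpace ℝ (Fin n) => ρ z.1 z.2 * v z.1 z.2 i)
      (I ×ˢ univ) :=
  hsol.contDiffOn_density.mul (contDiffOn_euclidean.1 hsol.contDiffOn_velocity i)

/-- The left-hand side is Reynolds' integrand for f = ρ, rewritten by div(ρv) = (v, ∇ρ) + ρ div v.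
-/
theorem materialDeriv_density (hsol : IsGDSolution γ I ρ v p) (hI : UniqueDiffOn ℝ I)
    (ht : t ∈ I) (x : EuclideanSpace ℝ (Fin n)) : materialDeriv I v ρ t x
      + ρ t x * LinearMap.trace ℝ (EuclideanSpace ℝ (Fin n)) (fderiv ℝ (v t) x) = 0 := by
  rw [materialDeriv_eq hI ht (hsol.contDiffOn_density.differentiableOn one_ne_zero), add_assoc,
    ← sum_partialDeriv_mul
      ((contDiff_slice_of_contDiffOn hsol.contDiffOn_density ht).differentiable one_ne_zero x)
      ((contDiff_slice_of_contDiffOn hsol.contDiffOn_velocity ht).differentiable one_ne_zero x)]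
  exact hsol.mass t ht x

theorem materialDeriv_momentum (hsol : IsGDSolution γ I ρ v p) (hI : UniqueDiffOn ℝ I)
    (ht : t ∈ I) (x : EuclideanSpace ℝ (Fin n)) (i : Fin n) :
    materialDeriv I v (fun τ y => ρ τ y * v τ y i) t x
      + ρ t x * v t x i * LinearMap.trace ℝ (EuclideanSpace ℝ (Fin n)) (fderiv ℝ (v t) x)
      = -partialDeriv i (p t) x := by
  rw [materialDeriv_eq hI ht ((hsol.contDiffOn_momentum i).differentiableOn one_ne_zero),
    add_assoc]
  have h1 := sum_partialDeriv_mul (w := fun y => ρ t y * v t y i) (u := v t)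
    ((contDiff_slice_of_contDiffOn (v := fun τ y => ρ τ y * v τ y i)
      (hsol.contDiffOn_momentum i) ht).differentiable one_ne_zero x)
    ((contDiff_slice_of_contDiffOn hsol.contDiffOn_velocity ht).differentiable one_ne_zero x)
  rw [← h1]
  linarith [hsol.momentum t ht x i]

variable {V : ℝ → Set (EuclideanSpace ℝ (Fin n))} {Φ : EuclideanSpace ℝ (Fin n) → ℝ}

/-- Reynolds' integrand for ρΦ is Φ(Dρ + ρ div v) + ρ DΦ; the bracket vanishes by conservation of
mass, and DΦ = (∇Φ, v). -/
theorem hasDerivWithinAt_integral_density_mul (hsol : IsGDSolution γ I ρ v p)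
    (hI : I.OrdConnected) (hI' : (interior I).Nonempty) (hmat : IsMaterialVolume I v V)
    (ht : t ∈ I) (hV : IsBoundedC1Domain (V t)) (hΦ : ContDiff ℝ 1 Φ) :
    HasDerivWithinAt (fun s => ∫ x in V s, ρ s x * Φ x)
      (∫ x in V t, ρ t x * fderiv ℝ Φ x (v t x)) I t := by
  have hud : UniqueDiffOn ℝ I := uniqueDiffOn_convex hI.convex hI'
  have hΦs : ContDiffOn ℝ 1 (fun z : ℝ × EuclideanSpace ℝ (Fin n) => Φ z.2) (I ×ˢ univ) :=
    (hΦ.comp contDiff_snd).contDiffOn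
  have h1 := hmat.hasDerivWithinAt_integral hI hI' hsol.contDiffOn_velocity
    (f := fun s x => ρ s x * Φ x) (hsol.contDiffOn_density.mul hΦs) ht hV.isOpen hV.isBounded
  convert! h1 using 1
  refine integral_congr_ae (Eventually.of_forall fun x => ?_)
  have h2 := materialDeriv_mul (v := v) (x := x) hud ht
    (hsol.contDiffOn_density.differentiableOn one_ne_zero)
    (h := fun _ => Φ) (hΦs.differentiableOn one_ne_zero)
  have h3 := hsol.materialDeriv_density hud ht x
  rw [materialDeriv_const_time hud ht (hΦ.differentiable one_ne_zero)] at h2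
  rw [materialDeriv] at h2
  simp only
  rw [h2]
  linear_combination (-Φ x) * h3

/-- With f = Σ ρ vᵢ ∂ᵢΦ the conservative momentum equation applies componentwise, so no division by
ρ occurs. The compact support of Φ makes p∇Φ admissible in the divergence theorem. -/
theorem hasDerivWithinAt_integral_momentum (hsol : IsGDSolution γ I ρ v p)
    (hI : I.OrdConnected) (hI' : (interior I).Nonempty) (hmat : IsMaterialVolume I v V)
    (ht : t ∈ I) (hV : IsBoundedC1Domain (V t))
    {ν : EuclideanSpace ℝ (Fin n) → EuclideanSpace ℝ (Fin n)}
    (hν : ∀ x ∈ frontier (V t), IsOuterUnitNormal (V t) x (ν x))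
    (hΦ : ContDiff ℝ 2 Φ) (hΦc : HasCompactSupport Φ) :
    HasDerivWithinAt (fun s => ∫ x in V s, ρ s x * fderiv ℝ Φ x (v s x))
      ((∫ x in V t, ρ t x * fderiv ℝ (fderiv ℝ Φ) x (v t x) (v t x))
        + (∫ x in V t, p t x * ∑ i, fderiv ℝ (fderiv ℝ Φ) x (EuclideanSpace.single i 1)
          (EuclideanSpace.single i 1))
        - ∫ x in frontier (V t), p t x * fderiv ℝ Φ x (ν x) ∂μHE[n - 1]) I t := by
  have hud : UniqueDiffOn ℝ I := uniqueDiffOn_convex hI.convex hI'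
  have hdΦ : ContDiff ℝ 1 (fderiv ℝ Φ) := hΦ.fderiv_right (by norm_num)
  have hddΦ : Continuous (fderiv ℝ (fderiv ℝ Φ)) := hdΦ.continuous_fderiv one_ne_zero
  set a : Fin n → EuclideanSpace ℝ (Fin n) → ℝ := fun i x =>
    fderiv ℝ Φ x (EuclideanSpace.single i 1) with ha
  have hac : ∀ i, ContDiff ℝ 1 (a i) := fun i => hdΦ.clm_apply contDiff_const
  have had : ∀ i x u, fderiv ℝ (a i) x u
      = fderiv ℝ (fderiv ℝ Φ) x u (EuclideanSpace.single i 1) := fun i x u => by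
    have h1 : HasFDerivAt (a i) _ x :=
      (hdΦ.differentiable one_ne_zero x).hasFDerivAt.clm_apply (hasFDerivAt_const _ x)
    rw [h1.fderiv]
    simp
  have has : ∀ i, HasCompactSupport (a i) := fun i =>
    (hΦc.fderiv (𝕜 := ℝ)).comp_left
      (g := fun A : EuclideanSpace ℝ (Fin n) →L[ℝ] ℝ => A (EuclideanSpace.single i 1)) (by simp)
  have hacs : ∀ i, ContDiffOn ℝ 1 (fun z : ℝ × EuclideanSpace ℝ (Fin n) => a i z.2)
      (I ×ˢ univ) := fun i => ((hac i).comp contDiff_snd).contDiffOn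
  have hsum : ∀ s x, ρ s x * fderiv ℝ Φ x (v s x) = ∑ i, ρ s x * v s x i * a i x := fun s x => by
    rw [clm_apply_eq_sum_single (fderiv ℝ Φ x), Finset.mul_sum]
    refine Finset.sum_congr rfl fun i _ => ?_
    simp only [ha, smul_eq_mul]
    ring
  have hp : ContDiff ℝ 1 (p t) := contDiff_slice_of_contDiffOn hsol.contDiffOn_pressure ht
  have hρ : Continuous (ρ t) :=
    (contDiff_slice_of_contDiffOn hsol.contDiffOn_density ht).continuous
  have hv : Continuous (v t) :=
    (contDiff_slice_of_contDiffOn hsol.contDiffOn_velocity ht).continuous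
  have h1 := hmat.hasDerivWithinAt_integral hI hI' hsol.contDiffOn_velocity
    (f := fun s x => ∑ i, ρ s x * v s x i * a i x)
    (ContDiffOn.sum fun i _ => (hsol.contDiffOn_momentum i).mul (hacs i)) ht hV.isOpen
    hV.isBounded
  simp only [hsum]
  convert! h1 using 1
  -- Pointwise identity: −(∇Φ, ∇p) = p ΔΦ − div(p∇Φ), the last sum being the divergence to be
  -- integrated over the boundary.
  have hint : ∀ x, fderivWithin ℝ (fun z : ℝ × EuclideanSpace ℝ (Fin n) =>
        ∑ i, ρ z.1 z.2 * v z.1 z.2 i * a i z.2) (I ×ˢ univ) (t, x) (1, v t x)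
        + (∑ i, ρ t x * v t x i * a i x)
          * LinearMap.trace ℝ (EuclideanSpace ℝ (Fin n)) (fderiv ℝ (v t) x)
      = ρ t x * fderiv ℝ (fderiv ℝ Φ) x (v t x) (v t x)
        + p t x * (∑ i, fderiv ℝ (fderiv ℝ Φ) x (EuclideanSpace.single i 1)
          (EuclideanSpace.single i 1))
        - ∑ i, fderiv ℝ (fun y => a i y * p t y) x (EuclideanSpace.single i 1) := fun x => by
    have h2 := materialDeriv_sum (v := v) (x := x) hud ht
      (G := fun i s x => ρ s x * v s x i * a i x)
      (fun i => ((hsol.contDiffOn_momentum i).mul (hacs i)).differentiableOn one_ne_zero)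
    rw [materialDeriv] at h2
    rw [h2, Finset.sum_mul, ← Finset.sum_add_distrib,
      clm_apply_eq_sum_single (fderiv ℝ (fderiv ℝ Φ) x (v t x)), Finset.mul_sum, Finset.mul_sum,
      ← Finset.sum_add_distrib, ← Finset.sum_sub_distrib]
    refine Finset.sum_congr rfl fun i _ => ?_
    have h3 := materialDeriv_mul (v := v) (x := x) hud ht (g := fun s x => ρ s x * v s x i)
      ((hsol.contDiffOn_momentum i).differentiableOn one_ne_zero)
      (h := fun _ => a i) ((hacs i).differentiableOn one_ne_zero)
    rw [materialDeriv_const_time hud ht ((hac i).differentiable one_ne_zero)] at h3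
    have h4 := hsol.materialDeriv_momentum hud ht x i
    have h5 := (((hac i).differentiable one_ne_zero x).hasFDerivAt.mul
      (hp.differentiable one_ne_zero x).hasFDerivAt).fderiv
    have h6 : fderiv ℝ (fun y => a i y * p t y) x (EuclideanSpace.single i 1)
        = a i x * partialDeriv i (p t) x
          + p t x * fderiv ℝ (a i) x (EuclideanSpace.single i 1) := by
      refine (DFunLike.congr_fun h5 _).trans ?_
      simp [partialDeriv]
    rw [h3, h6, had, had, smul_eq_mul]
    linear_combination (a i x) * h4
  simp only [hint]
  have hc1 : Continuous fun x => ρ t x * fderiv ℝ (fderiv ℝ Φ) x (v t x) (v t x) :=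
    hρ.mul ((hddΦ.clm_apply hv).clm_apply hv)
  have hc2 : Continuous fun x => p t x * ∑ i, fderiv ℝ (fderiv ℝ Φ) x
      (EuclideanSpace.single i 1) (EuclideanSpace.single i 1) :=
    hp.continuous.mul (continuous_finsetSum _ fun i _ =>
      (hddΦ.clm_apply continuous_const).clm_apply continuous_const)
  have hap : ∀ i, ContDiff ℝ 1 fun y => a i y * p t y := fun i => (hac i).mul hp
  have hc3 : ∀ i, Continuous fun x => fderiv ℝ (fun y => a i y * p t y) x
      (EuclideanSpace.single i 1) := fun i =>
    ((hap i).continuous_fderiv one_ne_zero).clm_apply continuous_const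
  have hb := hV.isBounded
  have hi : IntegrableOn (fun x => ρ t x * fderiv ℝ (fderiv ℝ Φ) x (v t x) (v t x)
      + p t x * ∑ i, fderiv ℝ (fderiv ℝ Φ) x (EuclideanSpace.single i 1)
        (EuclideanSpace.single i 1)) (V t) := (hc1.add hc2).integrableOn_of_isBounded hb
  rw [integral_sub hi
      ((continuous_finsetSum Finset.univ fun i _ => hc3 i).integrableOn_of_isBounded hb),
    integral_add (hc1.integrableOn_of_isBounded hb) (hc2.integrableOn_of_isBounded hb),
    integral_finsetSum _ fun i _ => (hc3 i).integrableOn_of_isBounded hb]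
  congr 1
  have hcν := hV.continuousOn_normal hν
  rw [Finset.sum_congr rfl fun i _ => hV.integral_fderiv_eq hν (hap i) (has i).mul_right _,
    ← integral_finsetSum]
  · refine integral_congr_ae (Eventually.of_forall fun x => ?_)
    simp only
    rw [clm_apply_eq_sum_single (fderiv ℝ Φ x), Finset.mul_sum]
    refine Finset.sum_congr rfl fun i _ => ?_
    rw [EuclideanSpace.inner_single_right]
    simp [ha]
    ring
  · intro i _
    exact hV.integrableOn_frontier hν ((hap i).continuous.continuousOn.mul
      (hcν.inner continuousOn_const))

end IsGDSolution

end GasDynamics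

/-! ### Cut-off and derivatives of radial functions. -/

section Radial

/-- Agreement on an open neighbourhood, not only on `K`, keeps the derivatives on `K` and allows the
volume to move. -/
theorem exists_contDiff_hasCompactSupport_eqOn {E : Type*} [NormedAddCommGroup E]
    [NormedSpace ℝ E] [FiniteDimensional ℝ E] {f : E → ℝ} {K : Set E} {m : ℕ}
    (hK : IsCompact K) (hf : ∀ x ∈ K, ContDiffAt ℝ m f x) :
    ∃ g : E → ℝ, ContDiff ℝ m g ∧ HasCompactSupport g ∧ ∃ O, IsOpen O ∧ K ⊆ O ∧ EqOn g f O := by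
  have hU : IsOpen {x | ContDiffAt ℝ m f x} :=
    isOpen_iff_mem_nhds.2 fun x hx => ContDiffAt.eventually hx (by simp)
  obtain ⟨L, hL, hKL, hLU⟩ := exists_compact_between hK hU hf
  obtain ⟨χ, h1, h0, -⟩ := exists_contMDiffMap_one_nhds_of_subset_interior
    (n := m) (modelWithCornersSelf ℝ E) hK.isClosed hKL
  obtain ⟨O, hO, hKO, hO1⟩ := eventually_nhdsSet_iff_exists.1 h1
  have hsupp : tsupport (fun x => χ x * f x) ⊆ L :=
    closure_minimal (fun x hx => by
      by_contra hxL
      exact hx (by simp [h0 x hxL])) hL.isClosed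
  refine ⟨fun x => χ x * f x, ?_, hL.of_isClosed_subset (isClosed_tsupport _) hsupp, O, hO, hKO,
    fun x hx => by simp [hO1 x hx]⟩
  exact contDiff_of_forall_mem_tsupport fun x hx =>
    χ.contMDiff.contDiff.contDiffAt.mul (hLU (hsupp hx))

variable {E : Type*} [NormedAddCommGroup E] [InnerProductSpace ℝ E] {φ : ℝ → ℝ} {x : E}

/-- Restrict the radial function to the ray through `x`, which is smooth in the radius. -/
theorem contDiffAt_of_comp_norm {m : WithTop ℕ∞} (hx : x ≠ 0)
    (h : ContDiffAt ℝ m (fun y : E => φ ‖y‖) x) : ContDiffAt ℝ m φ ‖x‖ := by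
  have hr : 0 < ‖x‖ := norm_pos_iff.2 hx
  have h1 : ContDiffAt ℝ m (fun s : ℝ => (s / ‖x‖) • x) ‖x‖ :=
    (contDiffAt_id.div_const _).smul contDiffAt_const
  have h2 : ContDiffAt ℝ m (fun s : ℝ => φ ‖(s / ‖x‖) • x‖) ‖x‖ :=
    ContDiffAt.comp ‖x‖ (g := fun y : E => φ ‖y‖) (by simpa [div_self hr.ne'] using h) h1
  refine h2.congr_of_eventuallyEq ?_
  filter_upwards [lt_mem_nhds hr] with s hs
  rw [norm_smul, Real.norm_of_nonneg (div_pos hs hr).le, div_mul_cancel₀ _ hr.ne']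

theorem hasFDerivAt_norm_of_ne_zero (hx : x ≠ 0) :
    HasFDerivAt (fun y : E => ‖y‖) (‖x‖⁻¹ • innerSL ℝ x) x := by
  have h1 := (hasStrictFDerivAt_norm_sq x).hasFDerivAt.sqrt (pow_ne_zero 2 (norm_ne_zero_iff.2 hx))
  simp only [Real.sqrt_sq (norm_nonneg _)] at h1
  convert! h1 using 1
  ext w
  simp
  field_simp

theorem hasFDerivAt_comp_norm (hx : x ≠ 0) (h : DifferentiableAt ℝ φ ‖x‖) :
    HasFDerivAt (fun y : E => φ ‖y‖) ((deriv φ ‖x‖ / ‖x‖) • innerSL ℝ x) x := by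
  have h1 := h.hasDerivAt.comp_hasFDerivAt x (hasFDerivAt_norm_of_ne_zero hx)
  convert! h1 using 1
  rw [smul_smul, div_eq_mul_inv]

/-- A radial function is even, so its derivative at the origin equals its own negative. -/
theorem fderiv_comp_norm_zero : fderiv ℝ (fun y : E => φ ‖y‖) 0 = 0 := by
  have h1 := fderiv_comp_smul (f := fun y : E => φ ‖y‖) (x := 0) (-1 : ℝ)
  simp only [norm_neg, smul_zero, neg_one_smul] at h1
  ext w
  exact self_eq_neg.1 (DFunLike.congr_fun h1 w)

theorem fderiv_comp_norm_apply (hx : x ≠ 0) (h : ContDiffAt ℝ 1 (fun y : E => φ ‖y‖) x) (w : E) :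
    fderiv ℝ (fun y : E => φ ‖y‖) x w = deriv φ ‖x‖ / ‖x‖ * ⟪x, w⟫_ℝ := by
  rw [(hasFDerivAt_comp_norm hx
    ((contDiffAt_of_comp_norm hx h).differentiableAt one_ne_zero)).fderiv]
  simp

theorem fderiv_fderiv_comp_norm_apply (hx : x ≠ 0)
    (h : ContDiffAt ℝ 2 (fun y : E => φ ‖y‖) x) (u w : E) :
    fderiv ℝ (fderiv ℝ (fun y : E => φ ‖y‖)) x u w
      = (deriv (deriv φ) ‖x‖ / ‖x‖ ^ 2 - deriv φ ‖x‖ / ‖x‖ ^ 3) * ⟪x, u⟫_ℝ * ⟪x, w⟫_ℝ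
        + deriv φ ‖x‖ / ‖x‖ * ⟪u, w⟫_ℝ := by
  have hr : ‖x‖ ≠ 0 := norm_ne_zero_iff.2 hx
  have hφ : ContDiffAt ℝ 2 φ ‖x‖ := contDiffAt_of_comp_norm hx h
  have hφ' : DifferentiableAt ℝ (deriv φ) ‖x‖ :=
    (hφ.derivWithin (m := 1) (by norm_num)).differentiableAt one_ne_zero
  have hev : (fun y => fderiv ℝ (fun z : E => φ ‖z‖) y w)
      =ᶠ[𝓝 x] fun y => deriv φ ‖y‖ / ‖y‖ * ⟪y, w⟫_ℝ := by
    filter_upwards [(h.of_le one_le_two).eventually (by simp), isOpen_ne.mem_nhds hx] with y hy hy0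
    exact fderiv_comp_norm_apply hy0 hy w
  have hd : DifferentiableAt ℝ (fderiv ℝ (fun y : E => φ ‖y‖)) x :=
    (h.fderiv_right (m := 1) (by norm_num)).differentiableAt one_ne_zero
  have h1 : HasFDerivAt (fun y => fderiv ℝ (fun z : E => φ ‖z‖) y w) _ x :=
    hd.hasFDerivAt.clm_apply (hasFDerivAt_const w x)
  have h2 : HasDerivAt (fun s => deriv φ s / s) _ ‖x‖ := hφ'.hasDerivAt.div (hasDerivAt_id _) hr
  have h3 : HasFDerivAt (fun y : E => deriv φ ‖y‖ / ‖y‖) _ x :=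
    h2.comp_hasFDerivAt x (hasFDerivAt_norm_of_ne_zero hx)
  have h4 : HasFDerivAt (fun y : E => ⟪y, w⟫_ℝ) _ x :=
    (hasFDerivAt_id x).inner ℝ (hasFDerivAt_const w x)
  have h5 := DFunLike.congr_fun (h1.unique ((h3.mul h4).congr_of_eventuallyEq hev)) u
  simp at h5
  rw [h5]
  field_simp
  ring

end Radial

/-! ### Radial and angular parts of the Hessian. -/

section EuclideanRadial

variable {n : ℕ}

/-- Lagrange's identity: the sum over all ordered pairs counts each pair i > j twice, and its
diagonal terms vanish. -/
theorem norm_angularPart_sq (u x : EuclideanSpace ℝ (Fin n)) :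
    ‖angularPart u x‖ ^ 2 = ‖u‖ ^ 2 * ‖x‖ ^ 2 - ⟪u, x⟫_ℝ ^ 2 := by
  set f : Fin n × Fin n → ℝ := fun q => (u q.1 * x q.2 - u q.2 * x q.1) ^ 2 with hf
  have h1 : ‖angularPart u x‖ ^ 2 = ∑ q : Fin n × Fin n, if q.2 < q.1 then f q else 0 := by
    rw [EuclideanSpace.real_norm_sq_eq, ← Finset.sum_filter]
    exact (Finset.sum_subtype (Finset.univ.filter fun q : Fin n × Fin n => q.2 < q.1)
      (p := fun q => q.2 < q.1) (by simp) f).symm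
  have h2 : ∑ q : Fin n × Fin n, (if q.1 < q.2 then f q else 0)
      = ∑ q : Fin n × Fin n, if q.2 < q.1 then f q else 0 := by
    rw [← Equiv.sum_comp (Equiv.prodComm (Fin n) (Fin n))]
    refine Finset.sum_congr rfl fun q _ => ?_
    simp only [hf, Equiv.prodComm_apply, Prod.fst_swap, Prod.snd_swap]
    congr 1
    ring
  have h3 : ∑ q, f q = 2 * ‖angularPart u x‖ ^ 2 := by
    rw [two_mul, h1]
    nth_rewrite 1 [← h2]
    rw [← Finset.sum_add_distrib]
    refine Finset.sum_congr rfl fun q _ => ?_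
    rcases lt_trichotomy q.1 q.2 with h | h | h
    · simp [h, h.not_gt]
    · simp [h, hf]
    · simp [h, h.not_gt]
  have h4 : ∑ q, f q = 2 * (‖u‖ ^ 2 * ‖x‖ ^ 2 - ⟪u, x⟫_ℝ ^ 2) := by
    have h5 : ∀ q : Fin n × Fin n, f q = u q.1 ^ 2 * x q.2 ^ 2 + x q.1 ^ 2 * u q.2 ^ 2
        - 2 * ((u q.1 * x q.1) * (u q.2 * x q.2)) := fun q => by
      simp only [hf]
      ring
    simp only [h5, Finset.sum_sub_distrib, Finset.sum_add_distrib, ← Finset.mul_sum,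
      Fintype.sum_prod_type, ← Finset.sum_mul]
    rw [EuclideanSpace.real_norm_sq_eq, EuclideanSpace.real_norm_sq_eq, real_inner_comm,
      PiLp.inner_apply]
    simp
    ring
  linarith

variable {φ : ℝ → ℝ} {Φ : EuclideanSpace ℝ (Fin n) → ℝ} {x : EuclideanSpace ℝ (Fin n)}

/-- Valid at the origin too: the left side vanishes by evenness, the right side because the inner
product with 0 is 0. -/
theorem fderiv_radial_apply (hΦ : ContDiff ℝ 2 Φ) (h : Φ =ᶠ[𝓝 x] fun y => φ ‖y‖)
    (w : EuclideanSpace ℝ (Fin n)) : fderiv ℝ Φ x w = deriv φ ‖x‖ / ‖x‖ * ⟪w, x⟫_ℝ := by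
  rw [h.fderiv_eq]
  rcases eq_or_ne x 0 with rfl | hx
  · simp [fderiv_comp_norm_zero]
  · rw [fderiv_comp_norm_apply hx
      ((hΦ.of_le one_le_two).contDiffAt.congr_of_eventuallyEq h.symm), real_inner_comm]

theorem fderiv_fderiv_radial_apply (hx : x ≠ 0) (hΦ : ContDiff ℝ 2 Φ)
    (h : Φ =ᶠ[𝓝 x] fun y => φ ‖y‖) (u w : EuclideanSpace ℝ (Fin n)) :
    fderiv ℝ (fderiv ℝ Φ) x u w
      = (deriv (deriv φ) ‖x‖ / ‖x‖ ^ 2 - deriv φ ‖x‖ / ‖x‖ ^ 3) * ⟪x, u⟫_ℝ * ⟪x, w⟫_ℝ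
        + deriv φ ‖x‖ / ‖x‖ * ⟪u, w⟫_ℝ := by
  rw [h.fderiv.fderiv_eq]
  exact fderiv_fderiv_comp_norm_apply hx (hΦ.contDiffAt.congr_of_eventuallyEq h.symm) u w

/-- Expresses φ'' through the continuous Hessian of Φ, which supplies measurability and a bound for
the integrand of I₁. -/
theorem fderiv_fderiv_radial_self (hx : x ≠ 0) (hΦ : ContDiff ℝ 2 Φ)
    (h : Φ =ᶠ[𝓝 x] fun y => φ ‖y‖) :
    fderiv ℝ (fderiv ℝ Φ) x x x = deriv (deriv φ) ‖x‖ * ‖x‖ ^ 2 := by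
  have hr : ‖x‖ ≠ 0 := norm_ne_zero_iff.2 hx
  rw [fderiv_fderiv_radial_apply hx hΦ h, real_inner_self_eq_norm_sq]
  field_simp
  ring

/-- By Lagrange's identity |u|² = ((u,x)² + |σ|²)/|x|², so the radial part of (φ'/|x|)|u|² cancels
the term −(φ'/|x|³)(u,x)². -/
theorem fderiv_fderiv_radial_diag (hx : x ≠ 0) (hΦ : ContDiff ℝ 2 Φ)
    (h : Φ =ᶠ[𝓝 x] fun y => φ ‖y‖) (u : EuclideanSpace ℝ (Fin n)) :
    fderiv ℝ (fderiv ℝ Φ) x u u = deriv (deriv φ) ‖x‖ / ‖x‖ ^ 2 * |⟪u, x⟫_ℝ| ^ 2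
      + deriv φ ‖x‖ / ‖x‖ ^ 3 * ‖angularPart u x‖ ^ 2 := by
  have hr : ‖x‖ ≠ 0 := norm_ne_zero_iff.2 hx
  rw [fderiv_fderiv_radial_apply hx hΦ h, norm_angularPart_sq, sq_abs, real_inner_self_eq_norm_sq,
    real_inner_comm]
  field_simp
  ring

theorem sum_fderiv_fderiv_radial (hx : x ≠ 0) (hΦ : ContDiff ℝ 2 Φ)
    (h : Φ =ᶠ[𝓝 x] fun y => φ ‖y‖) :
    ∑ i, fderiv ℝ (fderiv ℝ Φ) x (EuclideanSpace.single i 1) (EuclideanSpace.single i 1)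
      = deriv (deriv φ) ‖x‖ + ((n : ℝ) - 1) * (deriv φ ‖x‖ / ‖x‖) := by
  have hr : ‖x‖ ≠ 0 := norm_ne_zero_iff.2 hx
  have h1 : ∀ i : Fin n, fderiv ℝ (fderiv ℝ Φ) x (EuclideanSpace.single i 1)
      (EuclideanSpace.single i 1)
      = (deriv (deriv φ) ‖x‖ / ‖x‖ ^ 2 - deriv φ ‖x‖ / ‖x‖ ^ 3) * x i ^ 2
        + deriv φ ‖x‖ / ‖x‖ := fun i => by
    rw [fderiv_fderiv_radial_apply hx hΦ h, EuclideanSpace.inner_single_right]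
    simp
    ring
  simp only [h1, Finset.sum_add_distrib, ← Finset.mul_sum, ← EuclideanSpace.real_norm_sq_eq]
  simp
  field_simp
  ring

set_option maxSynthPendingDepth 3 in
/-- The part of the second derivative along the radial direction is integrable, although it need
not be continuous at the origin. -/
theorem integrableOn_fderiv_fderiv_self_mul (hΦ : ContDiff ℝ 2 Φ)
    {u : EuclideanSpace ℝ (Fin n) → EuclideanSpace ℝ (Fin n)}
    {ϱ : EuclideanSpace ℝ (Fin n) → ℝ} (hu : Continuous u) (hϱ : Continuous ϱ)
    {U : Set (EuclideanSpace ℝ (Fin n))} (hU : Bornology.IsBounded U) :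
    IntegrableOn (fun x => fderiv ℝ (fderiv ℝ Φ) x x x / ‖x‖ ^ 4 * |⟪u x, x⟫_ℝ| ^ 2 * ϱ x) U := by
  have hdd : Continuous (fderiv ℝ (fderiv ℝ Φ)) :=
    (hΦ.fderiv_right (m := 1) (by norm_num)).continuous_fderiv one_ne_zero
  -- Dominating function: |Hess Φ(x,x)| (u,x)² ≤ ‖Hess Φ‖ |u|² |x|⁴ cancels the denominator.
  have hi : IntegrableOn (fun x => ‖fderiv ℝ (fderiv ℝ Φ) x‖ * ‖u x‖ ^ 2 * |ϱ x|) U :=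
    Continuous.integrableOn_of_isBounded
      (F := fun x => ‖fderiv ℝ (fderiv ℝ Φ) x‖ * ‖u x‖ ^ 2 * |ϱ x|) ((hdd.norm.mul (hu.norm.pow 2)).mul hϱ.abs) hU
  refine Integrable.mono' hi ?_ (Eventually.of_forall fun x => ?_)
  · refine Measurable.aestronglyMeasurable ?_
    exact ((((hdd.clm_apply continuous_id).clm_apply continuous_id).measurable.div
      (continuous_norm.pow 4).measurable).mul ((hu.inner continuous_id).abs.pow 2).measurable).mul
      hϱ.measurable
  · rw [norm_mul, norm_mul, Real.norm_eq_abs (ϱ x)]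
    refine mul_le_mul_of_nonneg_right ?_ (abs_nonneg _)
    rcases eq_or_ne x 0 with rfl | hx
    · simp
      positivity
    have hr : 0 < ‖x‖ := norm_pos_iff.2 hx
    have h1 : ‖fderiv ℝ (fderiv ℝ Φ) x x x‖ ≤ ‖fderiv ℝ (fderiv ℝ Φ) x‖ * ‖x‖ * ‖x‖ :=
      ContinuousLinearMap.le_opNorm₂ _ _ _
    have h2 : |⟪u x, x⟫_ℝ| ≤ ‖u x‖ * ‖x‖ := abs_real_inner_le_norm _ _
    rw [norm_div, norm_pow, norm_norm, norm_pow, Real.norm_eq_abs |⟪u x, x⟫_ℝ|, abs_abs]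
    calc ‖fderiv ℝ (fderiv ℝ Φ) x x x‖ / ‖x‖ ^ 4 * |⟪u x, x⟫_ℝ| ^ 2
        ≤ ‖fderiv ℝ (fderiv ℝ Φ) x‖ * ‖x‖ * ‖x‖ / ‖x‖ ^ 4 * (‖u x‖ * ‖x‖) ^ 2 := by gcongr
      _ = ‖fderiv ℝ (fderiv ℝ Φ) x‖ * ‖u x‖ ^ 2 := by field_simp

/-- The origin is a null set because the dimension is positive; in dimension 0 it would be the whole
space. -/
theorem ae_mem_and_ne_zero (hn : n ≠ 0) {U : Set (EuclideanSpace ℝ (Fin n))} (hU : IsOpen U) :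
    ∀ᵐ x ∂volume.restrict U, x ∈ U ∧ x ≠ 0 := by
  have : Nonempty (Fin n) := ⟨⟨0, Nat.pos_of_ne_zero hn⟩⟩
  filter_upwards [ae_restrict_mem hU.measurableSet,
    ae_restrict_of_ae (Measure.ae_ne volume (0 : EuclideanSpace ℝ (Fin n)))] with x h1 h2
  exact ⟨h1, h2⟩

end EuclideanRadial

/-! ### Assembly of the two derivatives. -/

theorem lemma1 (n : ℕ) (hn : 1 ≤ n) (γ : ℝ) (hγ : 1 < γ)
    (I : Set ℝ) (hI : I.OrdConnected) (hI' : (interior I).Nonempty)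
    (ρ : ℝ → EuclideanSpace ℝ (Fin n) → ℝ)
    (v : ℝ → EuclideanSpace ℝ (Fin n) → EuclideanSpace ℝ (Fin n))
    (p : ℝ → EuclideanSpace ℝ (Fin n) → ℝ)
    (hsol : IsGDSolution γ I ρ v p)
    (V : ℝ → Set (EuclideanSpace ℝ (Fin n)))
    (hV : ∀ t ∈ I, IsBoundedC1Domain (V t))
    (hmat : IsMaterialVolume I v V)
    (ν : ℝ → EuclideanSpace ℝ (Fin n) → EuclideanSpace ℝ (Fin n))
    (hν : ∀ t ∈ I, ∀ x ∈ frontier (V t), IsOuterUnitNormal (V t) x (ν t x))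
    (φ : ℝ → ℝ)
    (hφ : ∀ t ∈ I, ∀ x ∈ closure (V t),
      ContDiffAt ℝ 2 (fun y : EuclideanSpace ℝ (Fin n) => φ ‖y‖) x)
    (t : ℝ) (ht : t ∈ I) :
    -- all the integrals exist
    (IntegrableOn (fun x => ρ t x * φ ‖x‖) (V t) ∧
      IntegrableOn (fun x => deriv φ ‖x‖ / ‖x‖ * ⟪v t x, x⟫_ℝ * ρ t x) (V t) ∧
      IntegrableOn
        (fun x => deriv (deriv φ) ‖x‖ / ‖x‖ ^ 2 * |⟪v t x, x⟫_ℝ| ^ 2 * ρ t x) (V t) ∧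
      IntegrableOn
        (fun x => deriv φ ‖x‖ / ‖x‖ ^ 3 * ‖angularPart (v t x) x‖ ^ 2 * ρ t x) (V t) ∧
      IntegrableOn
        (fun x => (deriv (deriv φ) ‖x‖ + ((n : ℝ) - 1) * (deriv φ ‖x‖ / ‖x‖)) * p t x) (V t) ∧
      IntegrableOn
        (fun x => deriv φ ‖x‖ / ‖x‖ * ⟪x, ν t x⟫_ℝ * p t x) (frontier (V t)) μHE[n - 1]) ∧
    -- the first derivative
    HasDerivWithinAt (generalizedMomentum φ ρ V)
      (∫ x in V t, deriv φ ‖x‖ / ‖x‖ * ⟪v t x, x⟫_ℝ * ρ t x) I t ∧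
    -- the second derivative
    HasDerivWithinAt (derivWithin (generalizedMomentum φ ρ V) I)
      ((∫ x in V t, deriv (deriv φ) ‖x‖ / ‖x‖ ^ 2 * |⟪v t x, x⟫_ℝ| ^ 2 * ρ t x)
        + (∫ x in V t, deriv φ ‖x‖ / ‖x‖ ^ 3 * ‖angularPart (v t x) x‖ ^ 2 * ρ t x)
        + (∫ x in V t, (deriv (deriv φ) ‖x‖ + ((n : ℝ) - 1) * (deriv φ ‖x‖ / ‖x‖)) * p t x)
        + -(∫ x in frontier (V t), deriv φ ‖x‖ / ‖x‖ * ⟪x, ν t x⟫_ℝ * p t x ∂μHE[n - 1]))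
      I t := by
  have hn0 : n ≠ 0 := Nat.one_le_iff_ne_zero.1 hn
  have hud : UniqueDiffOn ℝ I := uniqueDiffOn_convex hI.convex hI'
  have hv0 := hsol.contDiffOn_velocity
  have hcut : ∀ s ∈ I, ∃ Φ : EuclideanSpace ℝ (Fin n) → ℝ, ContDiff ℝ 2 Φ ∧ HasCompactSupport Φ ∧
      ∃ O, IsOpen O ∧ closure (V s) ⊆ O ∧ EqOn Φ (fun y => φ ‖y‖) O := fun s hs =>
    exists_contDiff_hasCompactSupport_eqOn (m := 2) (hV s hs).isBounded.isCompact_closure (hφ s hs)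
  -- One fixed Φ thus serves for all times near s, which differentiation requires.
  have hnear : ∀ s ∈ I, ∀ O, IsOpen O → closure (V s) ⊆ O → ∀ᶠ r in 𝓝[I] s, V r ⊆ O :=
    fun s hs O hO hVO => hmat.eventually_subset hI hI' hv0 hs (hV s hs).isBounded hO hVO
  have hfirst : ∀ s ∈ I, HasDerivWithinAt (generalizedMomentum φ ρ V)
      (∫ x in V s, deriv φ ‖x‖ / ‖x‖ * ⟪v s x, x⟫_ℝ * ρ s x) I s := by
    intro s hs
    obtain ⟨Φ, hΦ, -, O, hO, hVO, hΦO⟩ := hcut s hs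
    have hrad : ∀ x ∈ O, Φ =ᶠ[𝓝 x] fun y => φ ‖y‖ := fun x hx =>
      hΦO.eventuallyEq_of_mem (hO.mem_nhds hx)
    have hev : ∀ r ∈ I, V r ⊆ O → generalizedMomentum φ ρ V r = ∫ x in V r, ρ r x * Φ x :=
      fun r hr hrO => setIntegral_congr_fun (hV r hr).isOpen.measurableSet fun x hx => by
        simp only [hΦO (hrO hx)]
    have h1 := hsol.hasDerivWithinAt_integral_density_mul hI hI' hmat hs (hV s hs)
      (hΦ.of_le one_le_two)
    convert! h1.congr_of_eventuallyEq (f₁ := generalizedMomentum φ ρ V) ?_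
      (hev s hs (subset_closure.trans hVO)) using 1
    · refine setIntegral_congr_fun (hV s hs).isOpen.measurableSet fun x hx => ?_
      rw [fderiv_radial_apply hΦ (hrad x (hVO (subset_closure hx))), mul_comm]
    · filter_upwards [hnear s hs O hO hVO, self_mem_nhdsWithin] with r hrO hr
      exact hev r hr hrO
  obtain ⟨Φ, hΦ, hΦc, O, hO, hVO, hΦO⟩ := hcut t ht
  have hrad : ∀ x ∈ O, Φ =ᶠ[𝓝 x] fun y => φ ‖y‖ := fun x hx =>
    hΦO.eventuallyEq_of_mem (hO.mem_nhds hx)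
  have hVt : V t ⊆ O := subset_closure.trans hVO
  have hb := (hV t ht).isBounded
  have hm : MeasurableSet (V t) := (hV t ht).isOpen.measurableSet
  have hρ : Continuous (ρ t) :=
    (contDiff_slice_of_contDiffOn hsol.contDiffOn_density ht).continuous
  have hp : Continuous (p t) :=
    (contDiff_slice_of_contDiffOn hsol.contDiffOn_pressure ht).continuous
  have hv : Continuous (v t) := (contDiff_slice_of_contDiffOn hv0 ht).continuous
  have hd : Continuous (fderiv ℝ Φ) := hΦ.continuous_fderiv two_ne_zero
  have hdd : Continuous (fderiv ℝ (fderiv ℝ Φ)) :=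
    (hΦ.fderiv_right (m := 1) (by norm_num)).continuous_fderiv one_ne_zero
  have hae := ae_mem_and_ne_zero hn0 (hV t ht).isOpen
  have hi0 : IntegrableOn (fun x => ρ t x * φ ‖x‖) (V t) :=
    (Continuous.integrableOn_of_isBounded (F := fun x => ρ t x * Φ x)
      (hρ.mul hΦ.continuous) hb).congr_fun (fun x hx => by simp only [hΦO (hVt hx)]) hm
  have hi : IntegrableOn (fun x => deriv φ ‖x‖ / ‖x‖ * ⟪v t x, x⟫_ℝ * ρ t x) (V t) :=
    (Continuous.integrableOn_of_isBounded (F := fun x => fderiv ℝ Φ x (v t x) * ρ t x)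
      ((hd.clm_apply hv).mul hρ) hb).congr_fun
      (fun x hx => by simp only [fderiv_radial_apply hΦ (hrad x (hVt hx))]) hm
  have hi1 : IntegrableOn
      (fun x => deriv (deriv φ) ‖x‖ / ‖x‖ ^ 2 * |⟪v t x, x⟫_ℝ| ^ 2 * ρ t x) (V t) := by
    refine (integrableOn_fderiv_fderiv_self_mul hΦ hv hρ hb).congr ?_
    filter_upwards [hae] with x hx
    have hr : ‖x‖ ≠ 0 := norm_ne_zero_iff.2 hx.2
    rw [fderiv_fderiv_radial_self hx.2 hΦ (hrad x (hVt hx.1))]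
    field_simp
  have hi12 : IntegrableOn (fun x => ρ t x * fderiv ℝ (fderiv ℝ Φ) x (v t x) (v t x)) (V t) :=
    Continuous.integrableOn_of_isBounded (hρ.mul ((hdd.clm_apply hv).clm_apply hv)) hb
  have he12 : ∀ᵐ x ∂volume.restrict (V t), ρ t x * fderiv ℝ (fderiv ℝ Φ) x (v t x) (v t x)
      = deriv (deriv φ) ‖x‖ / ‖x‖ ^ 2 * |⟪v t x, x⟫_ℝ| ^ 2 * ρ t x
        + deriv φ ‖x‖ / ‖x‖ ^ 3 * ‖angularPart (v t x) x‖ ^ 2 * ρ t x := by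
    filter_upwards [hae] with x hx
    rw [fderiv_fderiv_radial_diag hx.2 hΦ (hrad x (hVt hx.1))]
    ring
  have hi2 : IntegrableOn
      (fun x => deriv φ ‖x‖ / ‖x‖ ^ 3 * ‖angularPart (v t x) x‖ ^ 2 * ρ t x) (V t) := by
    -- I₂ has no separate bound: its integrand is the continuous ρ Hess Φ(v,v) minus the integrand
    -- of I₁, almost everywhere.
    refine (hi12.sub hi1).congr ?_
    filter_upwards [he12] with x hx
    simp only [Pi.sub_apply]
    rw [hx]
    ring
  have he3 : ∀ᵐ x ∂volume.restrict (V t), p t x * ∑ i, fderiv ℝ (fderiv ℝ Φ) x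
        (EuclideanSpace.single i 1) (EuclideanSpace.single i 1)
      = (deriv (deriv φ) ‖x‖ + ((n : ℝ) - 1) * (deriv φ ‖x‖ / ‖x‖)) * p t x := by
    filter_upwards [hae] with x hx
    rw [sum_fderiv_fderiv_radial hx.2 hΦ (hrad x (hVt hx.1)), mul_comm]
  have hi3 : IntegrableOn
      (fun x => (deriv (deriv φ) ‖x‖ + ((n : ℝ) - 1) * (deriv φ ‖x‖ / ‖x‖)) * p t x) (V t) :=
    (Continuous.integrableOn_of_isBounded (hp.mul (continuous_finsetSum Finset.univ fun i _ =>
      (hdd.clm_apply continuous_const).clm_apply continuous_const)) hb).congr he3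
  -- Equality is needed at every boundary point: for n = 1 the surface measure is counting measure
  -- and the origin has positive mass.
  have he4 : EqOn (fun x => p t x * fderiv ℝ Φ x (ν t x))
      (fun x => deriv φ ‖x‖ / ‖x‖ * ⟪x, ν t x⟫_ℝ * p t x) (frontier (V t)) := fun x hx => by
    simp only
    rw [fderiv_radial_apply hΦ (hrad x (hVO (frontier_subset_closure hx))), real_inner_comm,
      mul_comm]
  have hmf : MeasurableSet (frontier (V t)) := isClosed_frontier.measurableSet
  have hi4 : IntegrableOn (fun x => deriv φ ‖x‖ / ‖x‖ * ⟪x, ν t x⟫_ℝ * p t x)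
      (frontier (V t)) μHE[n - 1] :=
    ((hV t ht).integrableOn_frontier (hν t ht) (hp.continuousOn.mul (hd.continuousOn.clm_apply
      ((hV t ht).continuousOn_normal (hν t ht))))).congr_fun he4 hmf
  refine ⟨⟨hi0, hi, hi1, hi2, hi3, hi4⟩, hfirst t ht, ?_⟩
  -- For r near t the first derivative is again an integral with the same Φ, so the momentum balance
  -- can be applied to it.
  have hev : ∀ r ∈ I, V r ⊆ O → derivWithin (generalizedMomentum φ ρ V) I r
      = ∫ x in V r, ρ r x * fderiv ℝ Φ x (v r x) := fun r hr hrO => by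
    rw [(hfirst r hr).derivWithin (hud r hr)]
    refine setIntegral_congr_fun (hV r hr).isOpen.measurableSet fun x hx => ?_
    rw [fderiv_radial_apply hΦ (hrad x (hrO hx)), mul_comm]
  have h1 := hsol.hasDerivWithinAt_integral_momentum hI hI' hmat ht (hV t ht) (hν t ht) hΦ hΦc
  rw [integral_congr_ae he12, integral_add hi1 hi2, integral_congr_ae he3,
    setIntegral_congr_fun hmf he4, sub_eq_add_neg] at h1
  refine h1.congr_of_eventuallyEq ?_ (hev t ht hVt)
  filter_upwards [hnear t ht O hO hVO, self_mem_nhdsWithin] with r hrO hr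
  exact hev r hr hrO
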